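/- Let $\psi=\Gamma'/\Gamma$ be the digamma function, $\psi'$, $\psi''$ its derivatives, $\gamma$ the Euler–Mascheroni constant, $\zeta$ the Riemann zeta function, and let ${}_4F_3(\ldots;1)$ denote the sum of the generalized hypergeometric series at unit argument. Throughout, $1/\Gamma$ is the entire reciprocal Gamma function, which vanishes at $0,-1,-2,\ldots$ For every complex $\mu\neq 0$ with $\operatorname{Re}\mu>-1$, both series below converge absolutely and $$\frac1\mu\,{}_4F_3\!\left(\begin{matrix}1,1,1,1\\2,2,1+\mu\end{matrix}\,\middle|\,1\right)=\tfrac12\psi''(\mu)-\Bigl[\psi'(\mu)+\frac{\pi^2}{6}\Bigr]\bigl[\gamma+\psi(\mu)\bigr]+2\zeta(3)+\Gamma(\mu)\sum_{l=0}^{\infty}\frac{(-1)^l\,\psi'(l+2)}{\Gamma(\mu-l-1)\,\Gamma(l+2)\,(l+1)}.$$ If $\mu=n$ is a positive integer, the series on the right terminates: its terms vanish for all $l\ge n-1$, so the identity holds with $\sum_{l=0}^{\infty}$ replaced by the finite sum $\sum_{l=0}^{n-2}$ (empty for $n=1$). -/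

import Mathlib

noncomputable section

/-- The `k`-th term `(a₁)ₖ ⋯ (aₚ)ₖ / ((b₁)ₖ ⋯ (b_q)ₖ) · zᵏ / k!` of the generalized hypergeometric
series, where `(x)ₖ = x (x + 1) ⋯ (x + k - 1)` is the rising factorial. -/
def hypergeometricTerm (a b : Multiset ℂ) (z : ℂ) (k : ℕ) : ℂ :=
  (a.map fun x => (ascPochhammer ℂ k).eval x).prod /
    (b.map fun x => (ascPochhammer ℂ k).eval x).prod * z ^ k / (k.factorial : ℂ)

/-- The generalized hypergeometric function `ₚF_q(a; b; z)`, as the sum of its series. -/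
def hypergeometricPFQ (a b : Multiset ℂ) (z : ℂ) : ℂ :=
  ∑' k : ℕ, hypergeometricTerm a b z k

/-- The polygamma function `ψ⁽ⁿ⁾`, the `n`-th derivative of the digamma function `ψ`. -/
def polygamma (n : ℕ) (s : ℂ) : ℂ :=
  iteratedDeriv n Complex.digamma s

/-- The term `(-1)ˡ ψ'(l + 2) / (Γ(μ - l - 1) Γ(l + 2) (l + 1))`.  Here `1 / Γ` is the entire
reciprocal Gamma function: it vanishes at the poles of `Γ`, and so does `(Complex.Gamma s)⁻¹`. -/
def polygammaSeriesTerm (μ : ℂ) (l : ℕ) : ℂ :=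
  (-1) ^ l * polygamma 1 (l + 2) *
    ((Complex.Gamma (μ - l - 1))⁻¹ * (Complex.Gamma (l + 2))⁻¹ * ((l : ℂ) + 1)⁻¹)

end

open Filter Topology Asymptotics

/-! Write aₘ(z) = (-1)ᵐ (z choose m). Up to elementary factors the left side is S(s) = ∑ B(j+1,
s)/(j+1)², and the Gamma-quotient series on the right is T(s) = -∑_{m≥1} aₘ(s-1) ψ'(m+1)/m. The
difference D of the two sides has period 1 and tends to 0 along s + N, so it vanishes.

Periodicity: B(j+1, s) - B(j+1, s+1) = B(j+2, s), together with ∑ B(j+1, s)/(j+1) = ψ'(s)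
(`hasSum_betaNat_div`), gives the increment of S. Pascal's rule removes the factor 1/m from the
increment of T, and summation by parts evaluates what remains (`hasSum_altBinom_mul_polygamma_one`),
starting from the Newton series γ + ψ(z+1) = -∑_{m≥1} aₘ(z)/m (`hasSum_altBinom_succ_div`).

Decay: for Re s ≥ 2, insert ψ'(l+2) = ∑ⱼ (l+2+j)⁻² into T, exchange sums and split into partial
fractions (`polygammaNewtonSeries_eq`). This reproduces S, π²/6·(γ+ψ) and -2ζ(3). Hence D = ψ'·(γ+ψ)
- ψ''/2 - ∑ B(j+1, s)(ψ(s+j+1) - ψ(j+1))/(j+1), each piece of which tends to 0 under s ↦ s + N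
because ψ' = O(1/Re s) and ψ(s+N) = o(N). -/

/-! ### Weierstrass product of Γ and the series of ψ -/

theorem Complex.natCast_add_one_le_norm_add {s : ℂ} (hs : 0 ≤ s.re) (k : ℕ) :
    (k : ℝ) + 1 ≤ ‖s + k + 1‖ := by
  refine le_trans ?_ (Complex.re_le_norm _)
  simp; linarith

theorem Complex.natCast_add_one_ne_zero (k : ℕ) : (k : ℂ) + 1 ≠ 0 := by
  exact_mod_cast Nat.succ_ne_zero k

theorem Complex.add_natCast_ne_zero {s : ℂ} (hs : -1 < s.re) (h0 : s ≠ 0) (k : ℕ) :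
    s + k ≠ 0 := by
  rcases Nat.eq_zero_or_pos k with rfl | hk
  · simpa using h0
  · intro h
    have h1 := congrArg Complex.re h
    have h2 : (1 : ℝ) ≤ k := by exact_mod_cast hk
    simp at h1
    linarith

theorem Complex.add_natCast_add_one_ne_zero {s : ℂ} (hs : -1 < s.re) (k : ℕ) :
    s + k + 1 ≠ 0 := by
  intro h
  have h1 := congrArg Complex.re h
  have h2 : (0 : ℝ) ≤ k := k.cast_nonneg
  simp at h1
  linarith

theorem summable_one_div_natCast_add_one_sq : Summable fun k : ℕ => 1 / ((k : ℝ) + 1) ^ 2 := by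
  have := (summable_nat_add_iff 1).2 (Real.summable_one_div_nat_pow.2 one_lt_two)
  simpa using this

/-- The logarithm of the `k`-th factor `e^{s/(k+1)} / (1 + s/(k+1))` in the Weierstrass product
of `Γ(s + 1)`. -/
noncomputable def logWeierstrassFactor (k : ℕ) (s : ℂ) : ℂ :=
  s / (k + 1) - Complex.log (1 + s / (k + 1))

theorem hasDerivAt_logWeierstrassFactor (k : ℕ) {s : ℂ} (hs : -1 < s.re) :
    HasDerivAt (logWeierstrassFactor k) (((k : ℂ) + 1)⁻¹ - (s + k + 1)⁻¹) s := by
  have hk := Complex.natCast_add_one_ne_zero k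
  have hsk := Complex.add_natCast_add_one_ne_zero hs k
  have hslit : 1 + s / (k + 1) ∈ Complex.slitPlane := by
    left
    have h : s / ((k : ℂ) + 1) = s / ((k + 1 : ℝ) : ℂ) := by push_cast; rfl
    have hk0 : (0 : ℝ) < k + 1 := by positivity
    have h2 : (0 : ℝ) ≤ k := k.cast_nonneg
    rw [h, Complex.add_re, Complex.div_ofReal_re, Complex.one_re]
    have : -1 < s.re / (k + 1) := by
      rw [lt_div_iff₀ hk0]; linarith
    linarith
  have h1 : HasDerivAt (fun s : ℂ => s / ((k : ℂ) + 1)) (((k : ℂ) + 1)⁻¹) s := by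
    simpa using (hasDerivAt_id s).div_const ((k : ℂ) + 1)
  have h2 := h1.sub ((h1.const_add 1).clog hslit)
  refine h2.congr_deriv ?_
  have : 1 + s / ((k : ℂ) + 1) ≠ 0 := Complex.slitPlane_ne_zero hslit
  have h3 : 1 + s / ((k : ℂ) + 1) = (s + k + 1) / (k + 1) := by field_simp; ring
  rw [h3]
  field_simp

theorem logWeierstrassFactor_deriv_bound {M : ℝ} {s : ℂ} (hs : -(1 / 2) < s.re) (hM : ‖s‖ ≤ M)
    (k : ℕ) : ‖((k : ℂ) + 1)⁻¹ - (s + k + 1)⁻¹‖ ≤ 2 * M * (1 / ((k : ℝ) + 1) ^ 2) := by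
  have hk := Complex.natCast_add_one_ne_zero k
  have hsk := Complex.add_natCast_add_one_ne_zero (by linarith : -1 < s.re) k
  have h1 : ((k : ℂ) + 1)⁻¹ - (s + k + 1)⁻¹ = s / ((k + 1) * (s + k + 1)) := by
    field_simp; ring
  have hn : ‖(k : ℂ) + 1‖ = k + 1 := by
    rw [← Nat.cast_succ, Complex.norm_natCast]; push_cast; rfl
  have hk0 : (0 : ℝ) ≤ k := k.cast_nonneg
  have h2 : ((k : ℝ) + 1) / 2 ≤ ‖s + k + 1‖ := by
    refine le_trans ?_ (Complex.re_le_norm _)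
    simp; linarith
  have hk1 : (0 : ℝ) < (k + 1) / 2 := by positivity
  rw [h1, norm_div, norm_mul, hn]
  calc ‖s‖ / ((k + 1) * ‖s + k + 1‖) ≤ M / ((k + 1) * ((k + 1) / 2)) := by
        gcongr
        exact (norm_nonneg s).trans hM
    _ = _ := by field_simp

theorem logWeierstrassFactor_aux {s : ℂ} (hs : -(1 / 2) < s.re) :
    Summable (fun k => logWeierstrassFactor k s) ∧
      HasDerivAt (fun z => ∑' k, logWeierstrassFactor k z)
        (∑' k : ℕ, (((k : ℂ) + 1)⁻¹ - (s + k + 1)⁻¹)) s := by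
  set M := ‖s‖ + 1
  -- The ball makes the derivative bound uniform. The abscissa -1/2 keeps the base point 0, where
  -- every term vanishes, inside the domain and still gives |z + k + 1| ≥ (k+1)/2.
  let t : Set ℂ := {z : ℂ | -(1 / 2) < z.re} ∩ Metric.ball 0 M
  have hopen : IsOpen t := (isOpen_lt continuous_const Complex.continuous_re).inter
    Metric.isOpen_ball
  have hconn : IsPreconnected t :=
    ((convex_halfSpace_re_gt _).inter (convex_ball 0 M)).isPreconnected
  have hu : Summable fun k : ℕ => 2 * M * (1 / ((k : ℝ) + 1) ^ 2) :=
    summable_one_div_natCast_add_one_sq.mul_left _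
  have hd : ∀ (k : ℕ) (z : ℂ), z ∈ t →
      HasDerivAt (logWeierstrassFactor k) (((k : ℂ) + 1)⁻¹ - (z + k + 1)⁻¹) z := fun k z hz =>
    hasDerivAt_logWeierstrassFactor k (by have := hz.1; simp at this; linarith)
  have hb : ∀ (k : ℕ) (z : ℂ), z ∈ t →
      ‖((k : ℂ) + 1)⁻¹ - (z + k + 1)⁻¹‖ ≤ 2 * M * (1 / ((k : ℝ) + 1) ^ 2) := fun k z hz =>
    logWeierstrassFactor_deriv_bound hz.1 (by have := hz.2; simp at this; exact this.le) k
  have h0 : (0 : ℂ) ∈ t := by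
    refine ⟨by norm_num, ?_⟩
    simp only [Metric.mem_ball, dist_self]; positivity
  have hs' : s ∈ t := ⟨hs, by simp [M]⟩
  have hg0 : Summable (logWeierstrassFactor · 0) := by
    simp [logWeierstrassFactor, summable_zero]
  exact ⟨summable_of_summable_hasDerivAt_of_isPreconnected hu hopen hconn hd hb h0 hg0 hs',
    hasDerivAt_tsum_of_isPreconnected hu hopen hconn hd hb h0 hg0 hs'⟩

/-- Compares the Weierstrass and Euler products at finite level; the correction factor tends to 1
since Hₙ - log n → γ. -/
theorem exp_sum_logWeierstrassFactor {s : ℂ} (hs : 0 < s.re) {n : ℕ} (hn : n ≠ 0) :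
    Complex.exp (-Real.eulerMascheroniConstant * s +
      ∑ k ∈ Finset.range n, logWeierstrassFactor k s) =
    s * Complex.GammaSeq s n *
      Complex.exp (s * ((harmonic n - Real.log n - Real.eulerMascheroniConstant : ℝ) : ℂ)) := by
  have hs0 : s ≠ 0 := by rintro rfl; simp at hs
  have hk : ∀ k : ℕ, 1 + s / ((k : ℂ) + 1) = (s + k + 1) / (k + 1) := fun k => by
    have := Complex.natCast_add_one_ne_zero k
    field_simp; ring
  have hkn : ∀ k : ℕ, 1 + s / ((k : ℂ) + 1) ≠ 0 := fun k => by
    rw [hk]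
    exact div_ne_zero (Complex.add_natCast_add_one_ne_zero (by linarith) k)
      (Complex.natCast_add_one_ne_zero k)
  have hsum : ∑ k ∈ Finset.range n, s / ((k : ℂ) + 1) = s * ((harmonic n : ℝ) : ℂ) := by
    simp [harmonic, Finset.mul_sum, div_eq_mul_inv]
  have hprod : ∏ k ∈ Finset.range n, (1 + s / ((k : ℂ) + 1)) =
      (∏ k ∈ Finset.range n, (s + ((k + 1 : ℕ) : ℂ))) / n.factorial := by
    rw [← Finset.prod_range_add_one_eq_factorial]
    push_cast
    rw [← Finset.prod_div_distrib]
    exact Finset.prod_congr rfl fun k _ => by rw [hk, add_assoc]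
  have hexp : Complex.exp (∑ k ∈ Finset.range n, logWeierstrassFactor k s) =
      Complex.exp (s * ((harmonic n : ℝ) : ℂ)) /
        ((∏ k ∈ Finset.range n, (s + ((k + 1 : ℕ) : ℂ))) / n.factorial) := by
    rw [← hprod, ← hsum, Complex.exp_sum, Complex.exp_sum, ← Finset.prod_div_distrib]
    refine Finset.prod_congr rfl fun k _ => ?_
    rw [logWeierstrassFactor, Complex.exp_sub, Complex.exp_log (hkn k)]
  rw [Complex.exp_add, hexp, Complex.GammaSeq, Finset.prod_range_succ',
    Complex.cpow_def_of_ne_zero (by exact_mod_cast hn)]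
  have hfac : (n.factorial : ℂ) ≠ 0 := by exact_mod_cast n.factorial_ne_zero
  have hp : ∏ k ∈ Finset.range n, (s + ((k + 1 : ℕ) : ℂ)) ≠ 0 := by
    refine Finset.prod_ne_zero_iff.2 fun k _ => ?_
    push_cast
    rw [← add_assoc]
    exact Complex.add_natCast_add_one_ne_zero (by linarith) k
  have he : Complex.exp (-Real.eulerMascheroniConstant * s) *
      Complex.exp (s * ((harmonic n : ℝ) : ℂ)) = Complex.exp (Complex.log n * s) *
      Complex.exp (s * ((harmonic n - Real.log n - Real.eulerMascheroniConstant : ℝ) : ℂ)) := by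
    rw [← Complex.exp_add, ← Complex.exp_add]
    congr 1
    push_cast
    rw [← Complex.natCast_log]
    ring
  field_simp
  simp only [Nat.cast_zero, add_zero]
  rw [eq_div_iff hs0, ← neg_mul, he]
  ring_nf

theorem Complex.Gamma_eq_exp_tsum_logWeierstrassFactor {s : ℂ} (hs : 0 < s.re) :
    Complex.Gamma s = Complex.exp (-Real.eulerMascheroniConstant * s +
      ∑' k, logWeierstrassFactor k s) / s := by
  have hs0 : s ≠ 0 := by rintro rfl; simp at hs
  have h1 : Tendsto (fun n => Complex.exp (-Real.eulerMascheroniConstant * s +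
      ∑ k ∈ Finset.range n, logWeierstrassFactor k s)) atTop
      (𝓝 (Complex.exp (-Real.eulerMascheroniConstant * s + ∑' k, logWeierstrassFactor k s))) :=
    (Complex.continuous_exp.tendsto _).comp (tendsto_const_nhds.add
      (logWeierstrassFactor_aux (by linarith)).1.hasSum.tendsto_sum_nat)
  have h2 : Tendsto (fun n : ℕ => s * Complex.GammaSeq s n *
      Complex.exp (s * ((harmonic n - Real.log n - Real.eulerMascheroniConstant : ℝ) : ℂ))) atTop
      (𝓝 (s * Complex.Gamma s * Complex.exp (s * ((0 : ℝ) : ℂ)))) := by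
    refine ((Complex.GammaSeq_tendsto_Gamma s).const_mul s).mul
      ((Complex.continuous_exp.tendsto _).comp (Tendsto.const_mul s
        ((Complex.continuous_ofReal.tendsto _).comp ?_)))
    simpa using Real.tendsto_harmonic_sub_log.sub_const Real.eulerMascheroniConstant
  have h3 := tendsto_nhds_unique (h1.congr' (by
    filter_upwards [eventually_ne_atTop 0] with n hn using exp_sum_logWeierstrassFactor hs hn)) h2
  rw [h3]
  simp
  field_simp

theorem Complex.digamma_eq_tsum {s : ℂ} (hs : 0 < s.re) :
    Complex.digamma s = -Real.eulerMascheroniConstant - s⁻¹ +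
      ∑' k : ℕ, (((k : ℂ) + 1)⁻¹ - (s + k + 1)⁻¹) := by
  have hs0 : s ≠ 0 := by rintro rfl; simp at hs
  have hev : Complex.Gamma =ᶠ[𝓝 s] fun s => Complex.exp (-Real.eulerMascheroniConstant * s +
      ∑' k, logWeierstrassFactor k s) / s := by
    filter_upwards [(isOpen_lt continuous_const Complex.continuous_re).mem_nhds hs] with z hz
    exact Complex.Gamma_eq_exp_tsum_logWeierstrassFactor hz
  have hd := ((((hasDerivAt_id s).const_mul (-(Real.eulerMascheroniConstant : ℂ))).add
    (logWeierstrassFactor_aux (by linarith : -(1 / 2) < s.re)).2).cexp.div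
      (hasDerivAt_id s) hs0).congr_of_eventuallyEq hev
  rw [Complex.digamma_def, logDeriv_apply, hd.deriv,
    Complex.Gamma_eq_exp_tsum_logWeierstrassFactor hs]
  have := Complex.exp_ne_zero (-Real.eulerMascheroniConstant * s + ∑' k, logWeierstrassFactor k s)
  simp only [id, Pi.add_apply]
  field_simp
  ring

theorem Complex.digamma_add_one_of_ne {s : ℂ} (hs : -1 < s.re) (h0 : s ≠ 0) :
    Complex.digamma (s + 1) = Complex.digamma s + s⁻¹ := by
  refine Complex.digamma_apply_add_one s fun m h => ?_
  exact Complex.add_natCast_ne_zero hs h0 m (by rw [h]; ring)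

theorem Complex.summable_inv_sub_inv {s : ℂ} (hs : 0 < s.re) :
    Summable fun k : ℕ => ((k : ℂ) + 1)⁻¹ - (s + k + 1)⁻¹ :=
  .of_norm_bounded (summable_one_div_natCast_add_one_sq.mul_left (2 * ‖s‖)) fun k =>
    logWeierstrassFactor_deriv_bound (by linarith) le_rfl k

theorem Complex.hasSum_digamma_add_one {s : ℂ} (hs : 0 < s.re) :
    HasSum (fun k : ℕ => ((k : ℂ) + 1)⁻¹ - (s + k + 1)⁻¹)
      (Real.eulerMascheroniConstant + Complex.digamma (s + 1)) := by
  have hs0 : s ≠ 0 := by rintro rfl; simp at hs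
  rw [Complex.digamma_add_one_of_ne (by linarith) hs0, Complex.digamma_eq_tsum hs]
  convert! (Complex.summable_inv_sub_inv hs).hasSum using 1
  ring

/-! ### Series, recurrences and growth of ψ, ψ', ψ'' -/

theorem Complex.natCast_add_one_pow_inv_bound {s : ℂ} (hs : 0 ≤ s.re) (k : ℕ) {p : ℕ}
    (hp : 2 ≤ p) : ‖((s + k + 1) ^ p)⁻¹‖ ≤ 1 / ((k : ℝ) + 1) ^ 2 := by
  have h1 := Complex.natCast_add_one_le_norm_add hs k
  have hk0 : (0 : ℝ) ≤ k := k.cast_nonneg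
  rw [norm_inv, norm_pow, one_div]
  gcongr
  calc ((k : ℝ) + 1) ^ 2 ≤ (k + 1) ^ p := pow_le_pow_right₀ (by linarith) hp
    _ ≤ _ := by gcongr

theorem Complex.summable_add_natCast_pow_inv {s : ℂ} (hs : 0 < s.re) {p : ℕ} (hp : 2 ≤ p) :
    Summable fun k : ℕ => ((s + k) ^ p)⁻¹ := by
  refine (summable_nat_add_iff 1).1 ?_
  refine .of_norm_bounded summable_one_div_natCast_add_one_sq fun k => ?_
  simpa [add_assoc] using Complex.natCast_add_one_pow_inv_bound hs.le k hp

theorem Complex.tsum_add_natCast_pow_inv {s : ℂ} (hs : 0 < s.re) {p : ℕ} (hp : 2 ≤ p) :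
    ∑' k : ℕ, ((s + k) ^ p)⁻¹ = (s ^ p)⁻¹ + ∑' k : ℕ, ((s + k + 1) ^ p)⁻¹ := by
  rw [(Complex.summable_add_natCast_pow_inv hs hp).tsum_eq_zero_add]
  simp [add_assoc]

theorem Complex.hasDerivAt_pow_inv {s : ℂ} (h0 : s ≠ 0) (p : ℕ) :
    HasDerivAt (fun s : ℂ => (s ^ (p + 1))⁻¹) (-(p + 1) * (s ^ (p + 2))⁻¹) s := by
  refine ((hasDerivAt_pow (p + 1) s).fun_inv (pow_ne_zero _ h0)).congr_deriv ?_
  push_cast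
  field_simp
  ring

theorem Complex.hasDerivAt_digamma_of_re_pos {s : ℂ} (hs : 0 < s.re) :
    HasDerivAt Complex.digamma (∑' k : ℕ, ((s + k) ^ 2)⁻¹) s := by
  have hs0 : s ≠ 0 := by rintro rfl; simp at hs
  have hopen : IsOpen {z : ℂ | 0 < z.re} := isOpen_lt continuous_const Complex.continuous_re
  have hev : Complex.digamma =ᶠ[𝓝 s] fun s => -Real.eulerMascheroniConstant - s⁻¹ +
      ∑' k : ℕ, (((k : ℂ) + 1)⁻¹ - (s + k + 1)⁻¹) := by
    filter_upwards [hopen.mem_nhds hs] with z hz using Complex.digamma_eq_tsum hz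
  have h1 : HasDerivAt (fun z : ℂ => ∑' k : ℕ, (((k : ℂ) + 1)⁻¹ - (z + k + 1)⁻¹))
      (∑' k : ℕ, ((s + k + 1) ^ 2)⁻¹) s := by
    refine hasDerivAt_tsum_of_isPreconnected summable_one_div_natCast_add_one_sq hopen
      (convex_halfSpace_re_gt 0).isPreconnected (fun k z hz => ?_)
      (fun k z hz => Complex.natCast_add_one_pow_inv_bound (le_of_lt hz) k le_rfl) hs
      (Complex.summable_inv_sub_inv hs) hs
    have hz' : 0 < z.re := hz
    have h := Complex.add_natCast_add_one_ne_zero (by linarith : -1 < z.re) k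
    have := ((((hasDerivAt_id z).add_const (k : ℂ)).add_const 1).fun_inv h).const_sub
      (((k : ℂ) + 1)⁻¹)
    refine this.congr_deriv ?_
    simp [neg_div]
  refine ((((hasDerivAt_inv hs0).const_sub (-(Real.eulerMascheroniConstant : ℂ))).add
    h1).congr_of_eventuallyEq hev).congr_deriv ?_
  rw [Complex.tsum_add_natCast_pow_inv hs le_rfl]
  simp

theorem Complex.hasDerivAt_tsum_add_natCast_sq_inv {s : ℂ} (hs : 0 < s.re) :
    HasDerivAt (fun s : ℂ => ∑' k : ℕ, ((s + k) ^ 2)⁻¹) (-2 * ∑' k : ℕ, ((s + k) ^ 3)⁻¹) s := by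
  have hs0 : s ≠ 0 := by rintro rfl; simp at hs
  have hopen : IsOpen {z : ℂ | 0 < z.re} := isOpen_lt continuous_const Complex.continuous_re
  have hev : (fun s : ℂ => ∑' k : ℕ, ((s + k) ^ 2)⁻¹) =ᶠ[𝓝 s] fun s => (s ^ 2)⁻¹ +
      ∑' k : ℕ, ((s + k + 1) ^ 2)⁻¹ := by
    filter_upwards [hopen.mem_nhds hs] with z hz using
      Complex.tsum_add_natCast_pow_inv hz le_rfl
  have h1 : HasDerivAt (fun z : ℂ => ∑' k : ℕ, ((z + k + 1) ^ 2)⁻¹)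
      (∑' k : ℕ, -2 * ((s + k + 1) ^ 3)⁻¹) s := by
    refine hasDerivAt_tsum_of_isPreconnected (u := fun k : ℕ => 2 * (1 / ((k : ℝ) + 1) ^ 2))
      (g := fun (k : ℕ) (z : ℂ) => ((z + k + 1) ^ 2)⁻¹)
      (g' := fun (k : ℕ) (z : ℂ) => -2 * ((z + k + 1) ^ 3)⁻¹)
      (summable_one_div_natCast_add_one_sq.mul_left 2) hopen
      (convex_halfSpace_re_gt 0).isPreconnected (fun k z hz => ?_)
      (fun k z hz => ?_) hs ?_ hs
    · have hz' : 0 < z.re := hz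
      have h := Complex.add_natCast_add_one_ne_zero (by linarith : -1 < z.re) k
      have := ((Complex.hasDerivAt_pow_inv h 1).comp_add_const (z + k) 1).comp_add_const z k
      refine this.congr_deriv ?_
      norm_num
    · rw [norm_mul, norm_neg, Complex.norm_ofNat]
      gcongr
      exact Complex.natCast_add_one_pow_inv_bound (le_of_lt hz) k (by norm_num)
    · exact .of_norm_bounded summable_one_div_natCast_add_one_sq fun k =>
        Complex.natCast_add_one_pow_inv_bound hs.le k le_rfl
  refine (((Complex.hasDerivAt_pow_inv hs0 1).add h1).congr_of_eventuallyEq hev).congr_deriv ?_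
  rw [Complex.tsum_add_natCast_pow_inv hs (by norm_num : 2 ≤ 3), tsum_mul_left]
  norm_num
  ring

theorem polygamma_one_eq_tsum {s : ℂ} (hs : 0 < s.re) :
    polygamma 1 s = ∑' k : ℕ, ((s + k) ^ 2)⁻¹ := by
  rw [polygamma, iteratedDeriv_one, (Complex.hasDerivAt_digamma_of_re_pos hs).deriv]

theorem hasSum_polygamma_one {s : ℂ} (hs : 0 < s.re) :
    HasSum (fun k : ℕ => ((s + k) ^ 2)⁻¹) (polygamma 1 s) := by
  rw [polygamma_one_eq_tsum hs]
  exact (Complex.summable_add_natCast_pow_inv hs le_rfl).hasSum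

theorem polygamma_two_eq_deriv (s : ℂ) : polygamma 2 s = deriv (polygamma 1) s := by
  rw [polygamma, iteratedDeriv_succ]; rfl

theorem hasDerivAt_polygamma_one_of_re_pos {s : ℂ} (hs : 0 < s.re) :
    HasDerivAt (polygamma 1) (-2 * ∑' k : ℕ, ((s + k) ^ 3)⁻¹) s := by
  refine (Complex.hasDerivAt_tsum_add_natCast_sq_inv hs).congr_of_eventuallyEq ?_
  filter_upwards [(isOpen_lt continuous_const Complex.continuous_re).mem_nhds hs] with z hz
  exact polygamma_one_eq_tsum hz

theorem polygamma_two_eq_tsum {s : ℂ} (hs : 0 < s.re) :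
    polygamma 2 s = -2 * ∑' k : ℕ, ((s + k) ^ 3)⁻¹ := by
  rw [polygamma_two_eq_deriv, (hasDerivAt_polygamma_one_of_re_pos hs).deriv]

theorem eventually_re_gt_neg_one_and_ne_zero {s : ℂ} (hs : -1 < s.re) (h0 : s ≠ 0) :
    ∀ᶠ z in 𝓝 s, -1 < z.re ∧ z ≠ 0 :=
  (Filter.Eventually.and ((isOpen_lt continuous_const Complex.continuous_re).mem_nhds hs)
    (isOpen_ne.mem_nhds h0) :)

/-- The series is available only on Re > 0, so the derivative at s is obtained by differentiating
the functional equation of ψ near s, with the series used at s + 1. -/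
theorem polygamma_one_add_one {s : ℂ} (hs : -1 < s.re) (h0 : s ≠ 0) :
    polygamma 1 (s + 1) = polygamma 1 s - (s ^ 2)⁻¹ := by
  have hs1 : 0 < (s + 1).re := by simp; linarith
  have hev : Complex.digamma =ᶠ[𝓝 s] fun z => Complex.digamma (z + 1) - z⁻¹ := by
    filter_upwards [eventually_re_gt_neg_one_and_ne_zero hs h0] with z hz
    rw [Complex.digamma_add_one_of_ne hz.1 hz.2]; ring
  have h1 := ((Complex.hasDerivAt_digamma_of_re_pos hs1).comp_add_const s 1).sub
    (hasDerivAt_inv h0)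
  have h2 := (h1.congr_of_eventuallyEq hev).deriv
  have h3 : polygamma 1 s = deriv Complex.digamma s := by rw [polygamma, iteratedDeriv_one]
  rw [h3, h2, polygamma_one_eq_tsum hs1]
  ring

theorem polygamma_two_add_one {s : ℂ} (hs : -1 < s.re) (h0 : s ≠ 0) :
    polygamma 2 (s + 1) = polygamma 2 s + 2 * (s ^ 3)⁻¹ := by
  have hs1 : 0 < (s + 1).re := by simp; linarith
  have hev : polygamma 1 =ᶠ[𝓝 s] fun z => polygamma 1 (z + 1) + (z ^ 2)⁻¹ := by
    filter_upwards [eventually_re_gt_neg_one_and_ne_zero hs h0] with z hz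
    rw [polygamma_one_add_one hz.1 hz.2]; ring
  have h1 := ((hasDerivAt_polygamma_one_of_re_pos hs1).comp_add_const s 1).add
    (Complex.hasDerivAt_pow_inv h0 1)
  have h2 := (h1.congr_of_eventuallyEq hev).deriv
  rw [polygamma_two_eq_deriv s, h2, polygamma_two_eq_tsum hs1]
  norm_num

theorem tendsto_polygamma_two_add_natCast {s : ℂ} (hs : 0 < s.re) :
    Tendsto (fun N : ℕ => polygamma 2 (s + N)) atTop (𝓝 0) := by
  have h := (tendsto_sum_nat_add fun k : ℕ => ((s + k) ^ 3)⁻¹).const_mul (-2)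
  rw [mul_zero] at h
  refine h.congr fun N => ?_
  rw [polygamma_two_eq_tsum (by simp; positivity)]
  congr 2
  ext k
  push_cast
  ring_nf

theorem polygamma_one_one : polygamma 1 1 = (Real.pi : ℂ) ^ 2 / 6 := by
  rw [polygamma_one_eq_tsum (by simp), ← riemannZeta_two]
  have := zeta_eq_tsum_one_div_nat_add_one_cpow (s := 2) (by simp)
  rw [this]
  congr 1
  ext k
  rw [Complex.cpow_ofNat, one_div, add_comm]

theorem Complex.digamma_add_natCast {s : ℂ} (hs : 0 < s.re) (N : ℕ) :
    Complex.digamma (s + N) = Complex.digamma s + ∑ i ∈ Finset.range N, (s + i)⁻¹ := by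
  induction N with
  | zero => simp
  | succ N ih =>
    have h : 0 < (s + N).re := by simp; positivity
    rw [Finset.sum_range_succ, ← add_assoc, ← ih, Nat.cast_succ, ← add_assoc,
      Complex.digamma_add_one_of_ne (by linarith) (by rintro h0; rw [h0] at h; simp at h)]

/-- ψ(s+N) - ψ(s) is a sum of N terms (s+i)⁻¹ tending to 0, so its Cesàro mean tends to 0;
logarithmic asymptotics are not needed. -/
theorem tendsto_digamma_add_natCast_div {s : ℂ} (hs : 0 < s.re) :
    Tendsto (fun N : ℕ => (N : ℝ)⁻¹ * ‖(Real.eulerMascheroniConstant : ℂ) +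
      Complex.digamma (s + N)‖) atTop (𝓝 0) := by
  have h1 : Tendsto (fun i : ℕ => (s + i)⁻¹) atTop (𝓝 0) := by
    refine tendsto_inv₀_cobounded.comp ?_
    rw [← tendsto_norm_atTop_iff_cobounded]
    refine tendsto_atTop_mono (fun i => ?_) (tendsto_natCast_atTop_atTop (R := ℝ))
    refine le_trans ?_ (Complex.re_le_norm _)
    simp; linarith
  have h2 := h1.cesaro_smul
  have h3 : Tendsto (fun N : ℕ => (N : ℝ)⁻¹ • ((Real.eulerMascheroniConstant : ℂ) +
      Complex.digamma s)) atTop (𝓝 0) := by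
    simpa using (tendsto_inv_atTop_nhds_zero_nat (𝕜 := ℝ)).smul_const
      ((Real.eulerMascheroniConstant : ℂ) + Complex.digamma s)
  have h4 := (h3.add h2).norm
  rw [add_zero, norm_zero] at h4
  refine h4.congr fun N => ?_
  rw [← smul_add, norm_smul, Complex.digamma_add_natCast hs, add_assoc]
  simp

/-! ### Signed binomials and Beta values: recurrences and decay -/

/-- The signed binomial coefficient `(-1) ^ m * (z choose m)`. -/
noncomputable def altBinom (z : ℂ) (m : ℕ) : ℂ :=
  ∏ i ∈ Finset.range m, (((i : ℂ) - z) / (i + 1))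

/-- The value `B(j + 1, s) = j! / (s (s + 1) ⋯ (s + j))` of the Beta function. -/
noncomputable def betaNat (s : ℂ) (j : ℕ) : ℂ :=
  (j.factorial : ℂ) / ∏ i ∈ Finset.range (j + 1), (s + i)

@[simp] theorem altBinom_zero (z : ℂ) : altBinom z 0 = 1 := by simp [altBinom]

theorem altBinom_succ (z : ℂ) (m : ℕ) :
    altBinom z (m + 1) = altBinom z m * ((m - z) / (m + 1)) := by
  rw [altBinom, Finset.prod_range_succ, altBinom]

theorem altBinom_add_one_succ (z : ℂ) (m : ℕ) :
    altBinom (z + 1) (m + 1) = -((z + 1) / (m + 1)) * altBinom z m := by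
  induction m with
  | zero => simp [altBinom_succ]
  | succ m ih =>
    rw [altBinom_succ, ih, altBinom_succ z m]
    have h1 := Complex.natCast_add_one_ne_zero m
    have h2 := Complex.natCast_add_one_ne_zero (m + 1)
    push_cast at h2 ⊢
    field_simp
    ring

theorem altBinom_pascal (z : ℂ) (m : ℕ) :
    altBinom (z + 1) (m + 1) = altBinom z (m + 1) - altBinom z m := by
  rw [altBinom_add_one_succ, altBinom_succ]
  have h1 := Complex.natCast_add_one_ne_zero m
  field_simp
  ring

@[simp] theorem betaNat_zero (s : ℂ) : betaNat s 0 = s⁻¹ := by simp [betaNat]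

theorem betaNat_succ (s : ℂ) (j : ℕ) :
    betaNat s (j + 1) = betaNat s j * ((j + 1) / (s + j + 1)) := by
  rw [betaNat, Finset.prod_range_succ, betaNat, Nat.factorial_succ, div_mul_div_comm]
  push_cast
  ring_nf

theorem betaNat_succ' (s : ℂ) (j : ℕ) :
    betaNat s (j + 1) = (j + 1) / s * betaNat (s + 1) j := by
  rw [betaNat, Finset.prod_range_succ', betaNat, Nat.factorial_succ, div_mul_div_comm]
  push_cast
  simp only [add_zero, mul_comm, add_assoc, add_comm (1 : ℂ)]

theorem betaNat_sub_betaNat_add_one {s : ℂ} (hs : -1 < s.re) (h0 : s ≠ 0) (j : ℕ) :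
    betaNat s j - betaNat (s + 1) j = betaNat s (j + 1) := by
  have h1 := Complex.natCast_add_one_ne_zero j
  have h2 := Complex.add_natCast_add_one_ne_zero hs j
  have h3 := betaNat_succ s j
  have h4 := betaNat_succ' s j
  have h5 : betaNat s j = betaNat s (j + 1) * ((s + j + 1) / (j + 1)) := by
    rw [h3]; field_simp
  have h6 : betaNat (s + 1) j = betaNat s (j + 1) * (s / (j + 1)) := by
    rw [h4]; field_simp
  rw [h5, h6]
  field_simp
  ring

theorem Complex.norm_natCast_cpow_of_ne_zero {n : ℕ} (hn : n ≠ 0) (s : ℂ) :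
    ‖(n : ℂ) ^ s‖ = (n : ℝ) ^ s.re :=
  Complex.norm_natCast_cpow_of_pos (Nat.pos_of_ne_zero hn) s

/-- `betaNat s j` is Euler's sequence for Γ(s) times j⁻ˢ, and Euler's sequence converges. -/
theorem betaNat_isBigO (s : ℂ) :
    betaNat s =O[atTop] fun j : ℕ => (j : ℝ) ^ (-s.re) := by
  have h : (fun j : ℕ => Complex.GammaSeq s j * (j : ℂ) ^ (-s)) =O[atTop]
      fun j : ℕ => (1 : ℝ) * (j : ℝ) ^ (-s.re) := by
    refine ((Complex.GammaSeq_tendsto_Gamma s).isBigO_one ℝ).mul (.of_bound 1 ?_)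
    filter_upwards [eventually_ne_atTop 0] with j hj
    rw [Complex.norm_natCast_cpow_of_ne_zero hj, Complex.neg_re, one_mul]
    exact le_abs_self _
  simp only [one_mul] at h
  refine h.congr' ?_ .rfl
  filter_upwards [eventually_ne_atTop 0] with j hj
  have hj' : (j : ℂ) ≠ 0 := by exact_mod_cast hj
  rw [Complex.GammaSeq, betaNat, Complex.cpow_neg]
  have : (j : ℂ) ^ s ≠ 0 := by simp [Complex.cpow_eq_zero_iff, hj']
  field_simp

theorem altBinom_succ_eq_inv_betaNat (z : ℂ) (m : ℕ) :
    altBinom z (m + 1) = (betaNat (-z) m)⁻¹ * ((m : ℂ) + 1)⁻¹ := by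
  have h1 := Complex.natCast_add_one_ne_zero m
  have h2 : (m.factorial : ℂ) ≠ 0 := by exact_mod_cast m.factorial_ne_zero
  have h3 : (∏ i ∈ Finset.range (m + 1), ((i : ℂ) + 1)) = (m + 1) * m.factorial := by
    have := Finset.prod_range_add_one_eq_factorial (m + 1)
    rw [Nat.factorial_succ] at this
    exact_mod_cast this
  rw [altBinom, Finset.prod_div_distrib, h3, betaNat, inv_div]
  simp only [neg_add_eq_sub]
  field_simp

theorem altBinom_natCast_eq_zero {n m : ℕ} (h : n < m) : altBinom n m = 0 :=
  Finset.prod_eq_zero (Finset.mem_range.2 h) (by simp)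

/-- Here Euler's sequence for Γ(-z) is inverted. When z is a natural number, -z is a pole, but the
binomials are then eventually zero. -/
theorem altBinom_succ_isBigO (z : ℂ) :
    (fun m => altBinom z (m + 1)) =O[atTop] fun m : ℕ => (m : ℝ) ^ (-(z.re + 1)) := by
  by_cases hz : ∀ n : ℕ, z ≠ n
  · have hG : Complex.Gamma (-z) ≠ 0 :=
      Complex.Gamma_ne_zero fun n h => hz n (neg_injective h)
    have h : (fun m : ℕ => (Complex.GammaSeq (-z) m)⁻¹ * ((m : ℂ) ^ (-z) * ((m : ℂ) + 1)⁻¹))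
        =O[atTop] fun m : ℕ => (1 : ℝ) * (m : ℝ) ^ (-(z.re + 1)) := by
      refine (((Complex.GammaSeq_tendsto_Gamma (-z)).inv₀ hG).isBigO_one ℝ).mul
        (.of_bound 1 ?_)
      filter_upwards [eventually_ne_atTop 0] with m hm
      have hm0 : (0 : ℝ) < m := by positivity
      rw [norm_mul, Complex.norm_natCast_cpow_of_ne_zero hm, Complex.neg_re, one_mul, norm_inv,
        Real.norm_of_nonneg (by positivity), ← Nat.cast_succ, Complex.norm_natCast, neg_add,
        Real.rpow_add hm0, Real.rpow_neg_one]
      gcongr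
      exact m.le_succ
    simp only [one_mul] at h
    refine h.congr' ?_ .rfl
    filter_upwards [eventually_ne_atTop 0] with m hm
    have hm' : (m : ℂ) ≠ 0 := by exact_mod_cast hm
    rw [altBinom_succ_eq_inv_betaNat, ← mul_assoc, Complex.GammaSeq, betaNat]
    have : (m : ℂ) ^ (-z) ≠ 0 := by simp [Complex.cpow_eq_zero_iff, hm']
    congr 1
    rw [inv_div, inv_div]
    field_simp
  · push Not at hz
    obtain ⟨n, rfl⟩ := hz
    refine (isBigO_zero _ _).congr' ?_ .rfl
    filter_upwards [eventually_ge_atTop n] with m hm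
    exact (altBinom_natCast_eq_zero (Nat.lt_succ_of_le hm)).symm

theorem natCast_add_one_isBigO :
    (fun m : ℕ => (m : ℂ) + 1) =O[atTop] fun m : ℕ => (m : ℝ) ^ (1 : ℝ) := by
  refine .of_bound 2 ?_
  filter_upwards [eventually_ge_atTop 1] with m hm
  have : (1 : ℝ) ≤ m := by exact_mod_cast hm
  rw [← Nat.cast_succ, Complex.norm_natCast, Real.rpow_one, Real.norm_natCast]
  push_cast
  linarith

theorem isBigO_mul_rpow {u v : ℕ → ℂ} {p q : ℝ} (hu : u =O[atTop] fun m : ℕ => (m : ℝ) ^ p)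
    (hv : v =O[atTop] fun m : ℕ => (m : ℝ) ^ q) :
    (fun m => u m * v m) =O[atTop] fun m : ℕ => (m : ℝ) ^ (p + q) := by
  refine (hu.mul hv).congr' .rfl ?_
  filter_upwards [eventually_gt_atTop 0] with m hm
  rw [Real.rpow_add (by exact_mod_cast hm)]

/-- Undoes the index shift through the absorption identity at z + 1, which divides by z + 1; at z =
-1 all coefficients equal 1. -/
theorem altBinom_isBigO (z : ℂ) :
    altBinom z =O[atTop] fun m : ℕ => (m : ℝ) ^ (-(z.re + 1)) := by
  by_cases hz : z + 1 = 0
  · have h1 : altBinom z = fun _ => 1 := by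
      ext m
      refine Finset.prod_eq_one fun i _ => ?_
      rw [eq_neg_of_add_eq_zero_left hz, sub_neg_eq_add,
        div_self (Complex.natCast_add_one_ne_zero i)]
    have h2 : z.re + 1 = 0 := by simpa using congrArg Complex.re hz
    rw [h1, h2]
    simpa using isBigO_refl (fun _ : ℕ => (1 : ℝ)) atTop
  · have h := ((isBigO_mul_rpow (altBinom_succ_isBigO (z + 1))
      natCast_add_one_isBigO).const_mul_left (-(z + 1)⁻¹))
    refine h.congr (fun m => ?_) (fun m => ?_)
    · rw [altBinom_add_one_succ]
      have := Complex.natCast_add_one_ne_zero m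
      field_simp
    · congr 1
      simp

theorem natCast_add_inv_pow_isBigO {j : ℕ} (p : ℕ) :
    (fun m : ℕ => (((m : ℂ) + j) ^ p)⁻¹) =O[atTop] fun m : ℕ => (m : ℝ) ^ (-(p : ℝ)) := by
  refine .of_bound 1 ?_
  filter_upwards [eventually_ge_atTop 1] with m hm
  have : (0 : ℝ) < m := by exact_mod_cast hm
  rw [norm_inv, norm_pow, ← Nat.cast_add, Complex.norm_natCast, Real.rpow_neg this.le,
    Real.rpow_natCast, one_mul, Real.norm_of_nonneg (by positivity)]
  gcongr
  simp

theorem summable_of_isBigO_rpow {u : ℕ → ℂ} {p : ℝ} (hu : u =O[atTop] fun m : ℕ => (m : ℝ) ^ p)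
    (hp : p < -1) : Summable u :=
  summable_of_isBigO_nat (Real.summable_nat_rpow.2 hp) hu

theorem tendsto_zero_of_isBigO_rpow {u : ℕ → ℂ} {p : ℝ}
    (hu : u =O[atTop] fun m : ℕ => (m : ℝ) ^ p) (hp : p < 0) : Tendsto u atTop (𝓝 0) := by
  refine hu.trans_tendsto ?_
  have := (tendsto_rpow_neg_atTop (neg_pos.2 hp)).comp (tendsto_natCast_atTop_atTop (R := ℝ))
  simpa [Function.comp_def] using this

/-! ### Telescoping sums and the Newton series of ψ -/

theorem hasSum_of_telescoping {f t : ℕ → ℂ} {L : ℂ} (hf : Summable f)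
    (h : ∀ n, f n = t n - t (n + 1)) (ht : Tendsto t atTop (𝓝 L)) : HasSum f (t 0 - L) := by
  rw [hf.hasSum_iff_tendsto_nat]
  simp only [h, Finset.sum_range_sub']
  exact ht.const_sub _

theorem summable_betaNat {s : ℂ} (hs : 1 < s.re) : Summable (betaNat s) :=
  summable_of_isBigO_rpow (betaNat_isBigO s) (by linarith)

theorem tendsto_betaNat {s : ℂ} (hs : 0 < s.re) : Tendsto (betaNat s) atTop (𝓝 0) :=
  tendsto_zero_of_isBigO_rpow (betaNat_isBigO s) (by linarith)

theorem summable_betaNat_div_pow {s : ℂ} {p : ℕ} (hs : 1 < s.re + p) :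
    Summable fun j : ℕ => betaNat s j * (((j : ℂ) + 1) ^ p)⁻¹ := by
  have := natCast_add_inv_pow_isBigO (j := 1) p
  push_cast at this
  exact summable_of_isBigO_rpow (isBigO_mul_rpow (betaNat_isBigO s) this) (by linarith)

theorem tendsto_altBinom {z : ℂ} (hz : -1 < z.re) : Tendsto (altBinom z) atTop (𝓝 0) :=
  tendsto_zero_of_isBigO_rpow (altBinom_isBigO z) (by linarith)

theorem summable_altBinom {z : ℂ} (hz : 0 < z.re) : Summable (altBinom z) :=
  summable_of_isBigO_rpow (altBinom_isBigO z) (by linarith)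

theorem summable_altBinom_div_pow {z : ℂ} {p : ℕ} (hz : 0 < z.re + p) (j : ℕ) :
    Summable fun m : ℕ => altBinom z m * (((m : ℂ) + j) ^ p)⁻¹ :=
  summable_of_isBigO_rpow (isBigO_mul_rpow (altBinom_isBigO z) (natCast_add_inv_pow_isBigO p))
    (by linarith)

theorem hasSum_betaNat_add_one {s : ℂ} (hs : 0 < s.re) :
    HasSum (betaNat (s + 1)) s⁻¹ := by
  have h0 : s ≠ 0 := by rintro rfl; simp at hs
  have := hasSum_of_telescoping (summable_betaNat (s := s + 1) (by simpa using hs))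
    (t := betaNat s) (fun j => by
      rw [← betaNat_sub_betaNat_add_one (by linarith) h0]; ring) (tendsto_betaNat hs)
  simpa using this

/-- This is (1 - 1)ᶻ = 0. By Pascal's rule the partial sums are the coefficients for z - 1, which
decay because Re (z - 1) > -1. -/
theorem hasSum_altBinom {z : ℂ} (hz : 0 < z.re) : HasSum (altBinom z) 0 := by
  have hz0 : z ≠ 0 := by rintro rfl; simp at hz
  have hz1 : z - 1 + 1 = z := by ring
  refine (hasSum_nat_add_iff' 1).1 ?_
  have h := hasSum_of_telescoping (f := fun m => altBinom z (m + 1))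
    (t := fun m => -altBinom (z - 1) m) ((summable_nat_add_iff 1).2 (summable_altBinom hz))
    (fun m => by
      have := altBinom_pascal (z - 1) m
      rw [hz1] at this
      rw [this]; ring)
    (tendsto_altBinom (z := z - 1) (by simpa using hz)).neg
  simpa using h

/-- The Newton series of `z ↦ 1 / (w + z)` at the natural number `w = k + 1`. -/
theorem hasSum_altBinom_mul_betaNat {z : ℂ} (hz : 0 < z.re) (k : ℕ) :
    HasSum (fun m => altBinom z m * betaNat (k + 1) m) (z + k + 1)⁻¹ := by
  -- The product is the reciprocal of the binomial coefficient (m+k choose k).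
  have hb : ∀ m : ℕ, ‖betaNat (k + 1) m * (k + 1 + m)‖ ≤ 1 := fun m => by
    induction m with
    | zero => simp [inv_mul_cancel₀ (Complex.natCast_add_one_ne_zero k)]
    | succ m ih =>
      have hne : (k : ℂ) + 1 + m + 1 ≠ 0 := by exact_mod_cast Nat.succ_ne_zero (k + 1 + m)
      have hne' : (k : ℂ) + 1 + m ≠ 0 := by
        have := Nat.succ_ne_zero (k + m)
        rw [add_right_comm]; exact_mod_cast this
      have h : betaNat (k + 1) (m + 1) * (k + 1 + ((m + 1 : ℕ) : ℂ)) =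
          betaNat (k + 1) m * (k + 1 + m) * (((m + 1 : ℕ) : ℂ) / ((k + 1 + m : ℕ) : ℂ)) := by
        rw [betaNat_succ]; push_cast; field_simp; ring
      rw [h, norm_mul, norm_div, Complex.norm_natCast, Complex.norm_natCast]
      refine mul_le_one₀ ih (by positivity) (div_le_one_of_le₀ ?_ (by positivity))
      exact_mod_cast (by omega : m + 1 ≤ k + 1 + m)
  have hb' : ∀ m : ℕ, ‖betaNat (k + 1) m‖ ≤ 1 := fun m => by
    refine le_trans ?_ (hb m)
    rw [norm_mul]
    refine le_mul_of_one_le_right (norm_nonneg _) ?_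
    have : (k : ℂ) + 1 + m = ((k + 1 + m : ℕ) : ℂ) := by push_cast; rfl
    rw [this, Complex.norm_natCast]
    exact_mod_cast (by omega : 1 ≤ k + 1 + m)
  have hne : z + k + 1 ≠ 0 := Complex.add_natCast_add_one_ne_zero (by linarith) k
  have hsum : Summable fun m => altBinom z m * betaNat (k + 1) m := by
    refine .of_norm_bounded (summable_altBinom hz).norm fun m => ?_
    rw [norm_mul]
    exact mul_le_of_le_one_right (norm_nonneg _) (hb' m)
  have ht : Tendsto (fun m : ℕ => altBinom z m * (betaNat (k + 1) m * (k + 1 + m))) atTop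
      (𝓝 0) := by
    refine squeeze_zero_norm (fun m => ?_) (by
      simpa using (tendsto_altBinom (by linarith : -1 < z.re)).norm)
    rw [norm_mul]
    exact mul_le_of_le_one_right (norm_nonneg _) (hb m)
  have h := hasSum_of_telescoping (hsum.mul_left (z + k + 1)) (fun m => by
    rw [betaNat_succ, altBinom_succ]
    have h1 := Complex.natCast_add_one_ne_zero m
    have h2 : (k : ℂ) + 1 + m + 1 ≠ 0 := by exact_mod_cast Nat.succ_ne_zero (k + 1 + m)
    push_cast
    field_simp
    ring) ht
  have h' := h.mul_left (z + k + 1)⁻¹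
  simp only [inv_mul_cancel_left₀ hne] at h'
  convert! h' using 1
  simp [inv_mul_cancel₀ (Complex.natCast_add_one_ne_zero k)]

theorem norm_betaNat_natCast_succ_le (k m : ℕ) :
    ‖betaNat (k + 1) (m + 1)‖ ≤ 1 / ((k : ℝ) + 1) ^ 2 := by
  have hk : ‖(k : ℂ) + 1‖ = k + 1 := by
    rw [← Nat.cast_succ, Complex.norm_natCast]; push_cast; rfl
  have step : ∀ j : ℕ, ‖((j : ℂ) + 1) / (k + 1 + j + 1)‖ ≤ ((j : ℝ) + 1) / (k + 1 + j + 1) :=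
    fun j => by
      have h1 : (j : ℂ) + 1 = ((j + 1 : ℕ) : ℂ) := by push_cast; rfl
      have h2 : (k : ℂ) + 1 + j + 1 = ((k + 1 + j + 1 : ℕ) : ℂ) := by push_cast; rfl
      rw [h1, h2, norm_div, Complex.norm_natCast, Complex.norm_natCast]
      push_cast
      exact le_rfl
  induction m with
  | zero =>
    rw [betaNat_succ, betaNat_zero, norm_mul, norm_inv, hk]
    have := step 0
    calc _ ≤ ((k : ℝ) + 1)⁻¹ * (((0 : ℕ) + 1) / (k + 1 + (0 : ℕ) + 1)) := by gcongr
      _ ≤ ((k : ℝ) + 1)⁻¹ * (1 / (k + 1)) := by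
        gcongr <;> norm_num
      _ = _ := by field_simp
  | succ m ih =>
    rw [betaNat_succ, norm_mul]
    refine le_trans (mul_le_of_le_one_right (norm_nonneg _) ((step _).trans ?_)) ih
    refine div_le_one_of_le₀ ?_ (by positivity)
    have : (0 : ℝ) ≤ k := k.cast_nonneg
    linarith

/-- Telescopes in k, since B(m+2, k+1) = B(m+1, k+1) - B(m+1, k+2); the boundary value is B(m+1, 1).
-/
theorem hasSum_betaNat_natCast (m : ℕ) :
    HasSum (fun k : ℕ => betaNat (k + 1) (m + 1)) ((m : ℂ) + 1)⁻¹ := by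
  have h1 : ∀ k : ℕ, (0 : ℝ) < ((k : ℂ) + 1).re := fun k => by simp; positivity
  have hlim : Tendsto (fun k : ℕ => betaNat (k + 1) m) atTop (𝓝 0) := by
    rcases m with _ | m
    · simpa using tendsto_one_div_add_atTop_nhds_zero_nat (𝕜 := ℂ)
    · refine squeeze_zero_norm (fun k => norm_betaNat_natCast_succ_le k m) ?_
      exact summable_one_div_natCast_add_one_sq.tendsto_atTop_zero
  have h := hasSum_of_telescoping (f := fun k : ℕ => betaNat (k + 1) (m + 1))
    (.of_norm_bounded summable_one_div_natCast_add_one_sq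
      fun k => norm_betaNat_natCast_succ_le k m)
    (t := fun k : ℕ => betaNat (k + 1) m)
    (fun k => by
      have h2 := h1 k
      rw [← betaNat_sub_betaNat_add_one (by linarith) (Complex.natCast_add_one_ne_zero k)]
      push_cast; rfl) hlim
  convert! h using 1
  have h3 : ∀ m : ℕ, betaNat 1 m = ((m : ℂ) + 1)⁻¹ := fun m => by
    induction m with
    | zero => simp
    | succ m ih =>
      have := Complex.natCast_add_one_ne_zero m
      rw [betaNat_succ, ih]
      push_cast
      field_simp
      ring
  simp [h3]

/-- Each term 1/(k+1) - 1/(z+k+1) of the series of γ + ψ(z+1) is a Newton series whose m = 0 term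
cancels. The double series is dominated by |aₘ₊₁(z)|/(k+1)², so the k-sum can be done first. -/
theorem hasSum_altBinom_succ_div_of_re_pos {z : ℂ} (hz : 0 < z.re) :
    HasSum (fun m : ℕ => -(altBinom z (m + 1) * ((m : ℂ) + 1)⁻¹))
      (Real.eulerMascheroniConstant + Complex.digamma (z + 1)) := by
  have hc : Summable fun m => altBinom z (m + 1) :=
    (summable_nat_add_iff 1).2 (summable_altBinom hz)
  have hsum : Summable fun x : ℕ × ℕ => -(altBinom z (x.1 + 1) * betaNat (x.2 + 1) (x.1 + 1)) := by
    refine .of_norm_bounded (hc.norm.mul_of_nonneg summable_one_div_natCast_add_one_sq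
      (fun _ => norm_nonneg _) (fun _ => by positivity)) fun x => ?_
    rw [norm_neg, norm_mul]
    gcongr
    exact norm_betaNat_natCast_succ_le _ _
  have h1 : ∀ m : ℕ, HasSum (fun k : ℕ => -(altBinom z (m + 1) * betaNat (k + 1) (m + 1)))
      (-(altBinom z (m + 1) * ((m : ℂ) + 1)⁻¹)) := fun m =>
    ((hasSum_betaNat_natCast m).mul_left _).neg
  have h2 : ∀ k : ℕ, HasSum (fun m : ℕ => -(altBinom z (m + 1) * betaNat (k + 1) (m + 1)))
      (((k : ℂ) + 1)⁻¹ - (z + k + 1)⁻¹) := fun k => by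
    have := ((hasSum_nat_add_iff' 1).2 (hasSum_altBinom_mul_betaNat hz k)).neg
    simpa using this
  have h3 := hsum.hasSum.prod_fiberwise h1
  have h4 := ((Equiv.prodComm ℕ ℕ).hasSum_iff.2 hsum.hasSum).prod_fiberwise h2
  rwa [(Complex.hasSum_digamma_add_one hz).unique h4]

/-- Absolute convergence of the double series fails to cover this strip; the identity is pulled back
from z + 1 by Pascal's rule and the vanishing of the full binomial sum. -/
theorem hasSum_altBinom_succ_div {z : ℂ} (hz : -1 < z.re) :
    HasSum (fun m : ℕ => -(altBinom z (m + 1) * ((m : ℂ) + 1)⁻¹))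
      (Real.eulerMascheroniConstant + Complex.digamma (z + 1)) := by
  have hz1 : 0 < (z + 1).re := by simp; linarith
  have h0 : z + 1 ≠ 0 := by intro h; rw [h] at hz1; simp at hz1
  have h1 := hasSum_altBinom_succ_div_of_re_pos hz1
  have h2 := ((hasSum_nat_add_iff' 1).2 (hasSum_altBinom hz1)).mul_left (z + 1)⁻¹
  rw [Complex.digamma_add_one_of_ne (by linarith) h0] at h1
  convert! h1.add h2 using 1
  · ext m
    have := Complex.natCast_add_one_ne_zero m
    have h3 := altBinom_pascal z m
    have h4 := altBinom_add_one_succ z m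
    have h5 : altBinom z m = -(altBinom (z + 1) (m + 1) * ((m + 1) / (z + 1))) := by
      rw [h4]; field_simp
    have h6 : altBinom z (m + 1) = altBinom (z + 1) (m + 1) + altBinom z m := by rw [h3]; ring
    rw [h6, h5]
    field_simp
    ring
  · simp
    ring

/-! ### The Beta series of ψ' -/

/-- The bound is exact at s = 2, where B(j+1, 2) = 1/((j+1)(j+2)). The factor 1/Re s is what makes
the Beta series vanish along s + N. -/
theorem norm_betaNat_le {s : ℂ} (hs : 2 ≤ s.re) (j : ℕ) :
    ‖betaNat s j‖ ≤ 2 / (s.re * ((j + 1) * (j + 2))) := by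
  have hs0 : 0 < s.re := by linarith
  induction j with
  | zero =>
    rw [betaNat_zero, norm_inv]
    calc ‖s‖⁻¹ ≤ s.re⁻¹ := by gcongr; exact Complex.re_le_norm s
      _ = _ := by norm_num; field_simp
  | succ j ih =>
    have h1 : (j : ℝ) + 3 ≤ ‖s + j + 1‖ := by
      refine le_trans ?_ (Complex.re_le_norm _)
      simp; linarith
    have h2 : ‖(j : ℂ) + 1‖ = j + 1 := by
      rw [← Nat.cast_succ, Complex.norm_natCast]; push_cast; rfl
    rw [betaNat_succ, norm_mul, norm_div, h2]
    calc _ ≤ 2 / (s.re * (((j : ℝ) + 1) * (j + 2))) * ((j + 1) / (j + 3)) := by gcongr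
      _ = _ := by push_cast; field_simp; ring

theorem norm_betaNat_div_le {s : ℂ} (hs : 2 ≤ s.re) (j : ℕ) :
    ‖betaNat s j * ((j : ℂ) + 1)⁻¹‖ ≤ 2 / s.re * (1 / ((j : ℝ) + 1) ^ 2) := by
  have hs0 : 0 < s.re := by linarith
  have h2 : ‖(j : ℂ) + 1‖ = j + 1 := by
    rw [← Nat.cast_succ, Complex.norm_natCast]; push_cast; rfl
  rw [norm_mul, norm_inv, h2]
  calc _ ≤ 2 / (s.re * (((j : ℝ) + 1) * (j + 2))) * ((j : ℝ) + 1)⁻¹ := by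
        gcongr; exact norm_betaNat_le hs j
    _ ≤ 2 / (s.re * (((j : ℝ) + 1) * 1)) * ((j : ℝ) + 1)⁻¹ := by
        gcongr
        have : (0 : ℝ) ≤ j := j.cast_nonneg
        linarith
    _ = _ := by field_simp

theorem norm_tsum_betaNat_div_le {s : ℂ} (hs : 2 ≤ s.re) :
    ‖∑' j : ℕ, betaNat s j * ((j : ℂ) + 1)⁻¹‖ ≤ 2 / s.re * ∑' j : ℕ, 1 / ((j : ℝ) + 1) ^ 2 := by
  rw [← tsum_mul_left]
  exact tsum_of_norm_bounded (summable_one_div_natCast_add_one_sq.mul_left _).hasSum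
    (norm_betaNat_div_le hs)

theorem summable_betaNat_div {s : ℂ} (hs : 0 < s.re) :
    Summable fun j : ℕ => betaNat s j * ((j : ℂ) + 1)⁻¹ := by
  have := summable_betaNat_div_pow (s := s) (p := 1) (by push_cast; linarith)
  simpa using this

theorem tsum_betaNat_div_sub {s : ℂ} (hs : 0 < s.re) :
    ∑' j : ℕ, betaNat s j * ((j : ℂ) + 1)⁻¹ - ∑' j : ℕ, betaNat (s + 1) j * ((j : ℂ) + 1)⁻¹ =
      (s ^ 2)⁻¹ := by
  have h0 : s ≠ 0 := by rintro rfl; simp at hs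
  have hs1 : 0 < (s + 1).re := by simp; linarith
  rw [← (summable_betaNat_div hs).tsum_sub (summable_betaNat_div hs1)]
  have h := (hasSum_betaNat_add_one hs).mul_left s⁻¹
  have h2 : s⁻¹ * s⁻¹ = (s ^ 2)⁻¹ := by rw [sq, mul_inv]
  rw [← h2, ← h.tsum_eq]
  congr 1
  ext j
  have := Complex.natCast_add_one_ne_zero j
  rw [← sub_mul, betaNat_sub_betaNat_add_one (by linarith) h0, betaNat_succ']
  field_simp

theorem Complex.re_add_natCast (s : ℂ) (N : ℕ) : (s + N).re = s.re + N := by simp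

theorem tendsto_inv_re_add_natCast (s : ℂ) :
    Tendsto (fun N : ℕ => (s + N).re⁻¹) atTop (𝓝 0) := by
  simp only [Complex.re_add_natCast]
  exact tendsto_inv_atTop_zero.comp
    (tendsto_atTop_add_const_left _ _ tendsto_natCast_atTop_atTop)

theorem eventually_two_le_re_add_natCast {s : ℂ} (hs : 0 < s.re) :
    ∀ᶠ N : ℕ in atTop, 2 ≤ (s + N).re := by
  filter_upwards [eventually_ge_atTop 2] with N hN
  have : (2 : ℝ) ≤ N := by exact_mod_cast hN
  rw [Complex.re_add_natCast]
  linarith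

theorem eq_zero_of_add_one_eq_of_tendsto {D : ℂ → ℂ} {s : ℂ} (hs : 0 < s.re)
    (hD : ∀ z : ℂ, 0 < z.re → D (z + 1) = D z)
    (hlim : Tendsto (fun N : ℕ => D (s + N)) atTop (𝓝 0)) : D s = 0 := by
  have h : ∀ N : ℕ, D (s + N) = D s := fun N => by
    induction N with
    | zero => simp
    | succ N ih =>
      rw [← ih, Nat.cast_succ, ← add_assoc, hD]
      simp; positivity
  simp only [h] at hlim
  exact tendsto_nhds_unique tendsto_const_nhds hlim

/-- Both sides drop by s⁻² under s ↦ s + 1 and tend to 0 along s + N, so their difference is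
periodic and null. -/
theorem hasSum_betaNat_div {s : ℂ} (hs : 0 < s.re) :
    HasSum (fun j : ℕ => betaNat s j * ((j : ℂ) + 1)⁻¹) (polygamma 1 s) := by
  have h1 : Tendsto (fun N : ℕ => polygamma 1 (s + N)) atTop (𝓝 0) := by
    refine (tendsto_sum_nat_add fun k : ℕ => ((s + k) ^ 2)⁻¹).congr fun N => ?_
    rw [polygamma_one_eq_tsum (by simp; positivity)]
    congr 1
    ext k
    push_cast
    ring_nf
  have h2 : Tendsto (fun N : ℕ => ∑' j : ℕ, betaNat (s + N) j * ((j : ℂ) + 1)⁻¹) atTop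
      (𝓝 0) := by
    have hb : Tendsto (fun N : ℕ => (s + N).re⁻¹ * (2 * ∑' j : ℕ, 1 / ((j : ℝ) + 1) ^ 2)) atTop
        (𝓝 0) := by
      have := (tendsto_inv_re_add_natCast s).mul_const (2 * ∑' j : ℕ, 1 / ((j : ℝ) + 1) ^ 2)
      rwa [zero_mul] at this
    refine squeeze_zero_norm' ?_ hb
    filter_upwards [eventually_two_le_re_add_natCast hs] with N hN
    refine (norm_tsum_betaNat_div_le hN).trans_eq ?_
    ring
  have h3 := eq_zero_of_add_one_eq_of_tendsto
    (D := fun z => ∑' j : ℕ, betaNat z j * ((j : ℂ) + 1)⁻¹ - polygamma 1 z) hs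
    (fun z hz => by
      have hz0 : z ≠ 0 := by rintro rfl; simp at hz
      rw [polygamma_one_add_one (by linarith) hz0, ← tsum_betaNat_div_sub hz]
      ring) (by simpa using h2.sub h1)
  rw [← sub_eq_zero.1 h3]
  exact (summable_betaNat_div hs).hasSum

theorem exists_norm_polygamma_one_le :
    ∃ C : ℝ, ∀ s : ℂ, 2 ≤ s.re → ‖polygamma 1 s‖ ≤ C / s.re := by
  refine ⟨2 * ∑' j : ℕ, 1 / ((j : ℝ) + 1) ^ 2, fun s hs => ?_⟩
  rw [← (hasSum_betaNat_div (by linarith)).tsum_eq]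
  refine (norm_tsum_betaNat_div_le hs).trans_eq ?_
  ring

theorem polygamma_one_natCast_isBigO :
    (fun l : ℕ => polygamma 1 ((l : ℂ) + 2)) =O[atTop] fun l : ℕ => (l : ℝ) ^ (-1 : ℝ) := by
  obtain ⟨C, hC⟩ := exists_norm_polygamma_one_le
  refine .of_bound C ?_
  filter_upwards [eventually_gt_atTop 0] with l hl
  have h : ((l : ℂ) + 2).re = l + 2 := by simp
  have hl0 : (0 : ℝ) < l := by exact_mod_cast hl
  have hC0 : 0 ≤ C := by
    have := (norm_nonneg _).trans (hC 2 (by simp))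
    rw [Complex.re_ofNat] at this
    linarith
  refine (hC _ (by rw [h]; linarith)).trans ?_
  rw [h, Real.rpow_neg_one, norm_inv, Real.norm_of_nonneg hl0.le, div_eq_mul_inv]
  gcongr
  linarith

/-! ### Unit-shift relations of the two series -/

/-- The series `∑ B(j + 1, s) / (j + 1)²`. -/
noncomputable def betaSqSeries (s : ℂ) : ℂ :=
  ∑' j : ℕ, betaNat s j * (((j : ℂ) + 1) ^ 2)⁻¹

theorem summable_betaNat_div_sq {s : ℂ} (hs : -1 < s.re) :
    Summable fun j : ℕ => betaNat s j * (((j : ℂ) + 1) ^ 2)⁻¹ :=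
  summable_betaNat_div_pow (by push_cast; linarith)

theorem betaSqSeries_sub {s : ℂ} (hs : -1 < s.re) (h0 : s ≠ 0) :
    betaSqSeries s - betaSqSeries (s + 1) = polygamma 1 (s + 1) / s := by
  have hs1 : 0 < (s + 1).re := by simp; linarith
  rw [betaSqSeries, betaSqSeries,
    ← (summable_betaNat_div_sq hs).tsum_sub (summable_betaNat_div_sq (by linarith)),
    div_eq_inv_mul, ← ((hasSum_betaNat_div hs1).mul_left s⁻¹).tsum_eq]
  congr 1
  ext j
  have := Complex.natCast_add_one_ne_zero j
  rw [← sub_mul, betaNat_sub_betaNat_add_one hs h0, betaNat_succ']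
  field_simp

theorem hasSum_altBinom_div_sq_one {s : ℂ} (hs : -1 < s.re) (h0 : s ≠ 0) :
    HasSum (fun m : ℕ => altBinom (s - 1) m * (((m : ℂ) + 1) ^ 2)⁻¹)
      (s⁻¹ * (Real.eulerMascheroniConstant + Complex.digamma (s + 1))) := by
  refine ((hasSum_altBinom_succ_div hs).mul_left s⁻¹).congr_fun fun m => ?_
  have h1 := Complex.natCast_add_one_ne_zero m
  have h := altBinom_add_one_succ (s - 1) m
  rw [sub_add_cancel] at h
  rw [h]
  field_simp

/-- Summation by parts: aₘ₊₁(s) is a difference of the aₘ(s-1), and ψ' has differences -(m+1)⁻². The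
boundary term is ψ'(1) = π²/6. -/
theorem hasSum_altBinom_mul_polygamma_one {s : ℂ} (hs : -1 < s.re) (h0 : s ≠ 0) :
    HasSum (fun m : ℕ => -(altBinom s (m + 1) * polygamma 1 ((m : ℂ) + 2)))
      ((Real.pi : ℂ) ^ 2 / 6 -
        s⁻¹ * (Real.eulerMascheroniConstant + Complex.digamma (s + 1))) := by
  have hrec : ∀ m : ℕ, polygamma 1 ((m : ℂ) + 2) =
      polygamma 1 ((m : ℂ) + 1) - (((m : ℂ) + 1) ^ 2)⁻¹ := fun m => by
    have hre : -1 < ((m : ℂ) + 1).re := by simp; linarith [m.cast_nonneg (α := ℝ)]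
    rw [← polygamma_one_add_one hre (Complex.natCast_add_one_ne_zero m)]
    congr 1
    ring
  have hpas : ∀ m : ℕ, altBinom s (m + 1) = altBinom (s - 1) (m + 1) - altBinom (s - 1) m :=
    fun m => by rw [← altBinom_pascal, sub_add_cancel]
  have hQ := hasSum_altBinom_div_sq_one hs h0
  have hsum : Summable fun m : ℕ => -(altBinom s (m + 1) * polygamma 1 ((m : ℂ) + 2)) :=
    (summable_of_isBigO_rpow
      (isBigO_mul_rpow (altBinom_succ_isBigO s) polygamma_one_natCast_isBigO) (by linarith)).neg
  have ht : Tendsto (fun m : ℕ => altBinom (s - 1) m * polygamma 1 ((m : ℂ) + 1)) atTop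
      (𝓝 0) := by
    have h1 := tendsto_zero_of_isBigO_rpow
      (isBigO_mul_rpow (altBinom_isBigO (s - 1)) polygamma_one_natCast_isBigO)
      (by simp; linarith)
    have h2 := h1.add hQ.summable.tendsto_atTop_zero
    rw [add_zero] at h2
    refine h2.congr fun m => ?_
    rw [hrec]
    ring
  have h := hasSum_of_telescoping (hsum.add hQ.summable) (fun m => by
    rw [hpas, hrec]
    push_cast
    rw [add_assoc (m : ℂ) 1 1, one_add_one_eq_two, hrec]
    ring) ht
  have h' := h.sub hQ
  simpa [polygamma_one_one] using h'

/-- The series `-∑ (-1)ᵐ (s - 1 choose m) ψ'(m + 1) / m` over `m = l + 1 ≥ 1`. -/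
noncomputable def polygammaNewtonSeries (s : ℂ) : ℂ :=
  ∑' l : ℕ, -(altBinom (s - 1) (l + 1) * polygamma 1 ((l : ℂ) + 2) * ((l : ℂ) + 1)⁻¹)

theorem summable_polygammaNewtonSeries {s : ℂ} (hs : -1 < s.re) :
    Summable fun l : ℕ =>
      -(altBinom (s - 1) (l + 1) * polygamma 1 ((l : ℂ) + 2) * ((l : ℂ) + 1)⁻¹) := by
  have h := natCast_add_inv_pow_isBigO (j := 1) 1
  simp only [Nat.cast_one, pow_one] at h
  exact (summable_of_isBigO_rpow (isBigO_mul_rpow (isBigO_mul_rpow (altBinom_succ_isBigO (s - 1))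
    polygamma_one_natCast_isBigO) h) (by simp; linarith)).neg

/-- Pascal and absorption turn the difference of coefficients into a multiple (l+1)/s of aₗ₊₁(s),
which cancels the denominator l + 1. -/
theorem polygammaNewtonSeries_sub {s : ℂ} (hs : -1 < s.re) (h0 : s ≠ 0) :
    polygammaNewtonSeries (s + 1) - polygammaNewtonSeries s =
      s⁻¹ * ((Real.pi : ℂ) ^ 2 / 6 -
        s⁻¹ * (Real.eulerMascheroniConstant + Complex.digamma (s + 1))) := by
  rw [polygammaNewtonSeries, polygammaNewtonSeries,
    ← (summable_polygammaNewtonSeries (by simp; linarith)).tsum_sub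
      (summable_polygammaNewtonSeries hs),
    ← ((hasSum_altBinom_mul_polygamma_one hs h0).mul_left s⁻¹).tsum_eq]
  congr 1
  ext l
  have h1 := Complex.natCast_add_one_ne_zero l
  have h2 := altBinom_add_one_succ (s - 1) l
  have h3 := altBinom_pascal (s - 1) l
  rw [sub_add_cancel] at h2 h3
  have h4 : altBinom (s - 1) l = -(altBinom s (l + 1) * ((l + 1) / s)) := by
    rw [h2]; field_simp
  have h5 : altBinom (s - 1) (l + 1) = altBinom s (l + 1) + altBinom (s - 1) l := by rw [h3]; ring
  rw [add_sub_cancel_right, h5, h4]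
  field_simp
  ring

/-! ### Binomial sums with simple and double poles -/

theorem tendsto_natCast_mul_altBinom_div {z : ℂ} (hz : -1 < z.re) (j : ℕ) (p : ℕ) :
    Tendsto (fun m : ℕ => altBinom z m * (m * (((m : ℂ) + (j + 1)) ^ (p + 1))⁻¹)) atTop
      (𝓝 0) := by
  refine squeeze_zero_norm (fun m => ?_) (by simpa using (tendsto_altBinom hz).norm)
  rw [norm_mul]
  refine mul_le_of_le_one_right (norm_nonneg _) ?_
  have h : (m : ℂ) + (j + 1) = ((m + (j + 1) : ℕ) : ℂ) := by push_cast; rfl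
  rw [norm_mul, norm_inv, norm_pow, h, Complex.norm_natCast, Complex.norm_natCast,
    ← div_eq_mul_inv]
  refine div_le_one_of_le₀ ?_ (by positivity)
  have h1 : (1 : ℝ) ≤ ((m + (j + 1) : ℕ) : ℝ) := by
    exact_mod_cast (by omega : 1 ≤ m + (j + 1))
  refine le_trans ?_ (le_self_pow₀ h1 (Nat.succ_ne_zero p))
  exact_mod_cast (by omega : m ≤ m + (j + 1))

theorem natCast_add_natCast_add_one_ne_zero (m j : ℕ) : (m : ℂ) + (j + 1) ≠ 0 := by
  exact_mod_cast Nat.succ_ne_zero (m + j)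

theorem summable_altBinom_div {s : ℂ} (hs : 0 < s.re) (j p : ℕ) :
    Summable fun m : ℕ => altBinom (s - 1) m * (((m : ℂ) + (j + 1)) ^ (p + 1))⁻¹ := by
  have := summable_altBinom_div_pow (z := s - 1) (p := p + 1) (by simp; positivity) (j + 1)
  simpa using this

/-- Formally ∫₀¹ tʲ(1-t)ˢ⁻¹ dt expanded binomially. Without integrals: writing A(x) for the sum with
denominators m + x, telescoping gives (s+x)A(x+1) = xA(x) at x = j + 1. -/
theorem hasSum_altBinom_div {s : ℂ} (hs : 0 < s.re) (j : ℕ) :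
    HasSum (fun m : ℕ => altBinom (s - 1) m * ((m : ℂ) + (j + 1))⁻¹) (betaNat s j) := by
  have h0 : s ≠ 0 := by rintro rfl; simp at hs
  have hz : -1 < (s - 1).re := by simpa using hs
  have hS : ∀ j : ℕ, Summable fun m : ℕ => altBinom (s - 1) m * ((m : ℂ) + (j + 1))⁻¹ :=
    fun j => by simpa using summable_altBinom_div hs j 0
  induction j with
  | zero =>
    have h := hasSum_of_telescoping ((hS 0).mul_left s) (t := altBinom (s - 1)) (fun m => by
      rw [altBinom_succ]
      have := Complex.natCast_add_one_ne_zero m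
      push_cast
      rw [zero_add]
      field_simp
      ring) (tendsto_altBinom hz)
    have h' := h.mul_left s⁻¹
    simpa [inv_mul_cancel_left₀ h0] using h'
  | succ j ih =>
    have hne : s + j + 1 ≠ 0 := Complex.add_natCast_add_one_ne_zero (by linarith) j
    have h := hasSum_of_telescoping
      (((hS (j + 1)).mul_left (s + j + 1)).sub (ih.summable.mul_left ((j : ℂ) + 1)))
      (t := fun m => altBinom (s - 1) m * (m * (((m : ℂ) + (j + 1)) ^ (0 + 1))⁻¹)) (fun m => by
        rw [altBinom_succ]
        have h1 := Complex.natCast_add_one_ne_zero m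
        have h2 := natCast_add_natCast_add_one_ne_zero m j
        have h3 := natCast_add_natCast_add_one_ne_zero m (j + 1)
        have h4 : (m : ℂ) + 1 + (j + 1) ≠ 0 := by
          have := natCast_add_natCast_add_one_ne_zero (m + 1) j
          push_cast at this; exact this
        push_cast at h3 ⊢
        rw [pow_one, pow_one, show (m : ℂ) + (j + 1 + 1) = m + 1 + (j + 1) by ring]
        field_simp
        ring) (tendsto_natCast_mul_altBinom_div hz j 0)
    have h' := (h.add (ih.mul_left ((j : ℂ) + 1))).mul_left (s + j + 1)⁻¹
    simp only [sub_add_cancel, inv_mul_cancel_left₀ hne] at h'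
    convert! h' using 1
    rw [betaNat_succ]
    simp
    field_simp

/-- This is -A'(x) at x = j + 1, for A(x) = B(x, s); the bracket is ψ(s+j+1) - ψ(j+1). The induction
uses the x-derivative of the recurrence for A, (s+x)Q(x+1) = xQ(x) + A(x+1) - A(x) with Q = -A',
again proved by telescoping. -/
theorem hasSum_altBinom_div_sq {s : ℂ} (hs : 0 < s.re) (j : ℕ) :
    HasSum (fun m : ℕ => altBinom (s - 1) m * (((m : ℂ) + (j + 1)) ^ 2)⁻¹)
      (betaNat s j * (Real.eulerMascheroniConstant + Complex.digamma s +
        (∑ i ∈ Finset.range (j + 1), (s + i)⁻¹ - ∑ i ∈ Finset.range j, ((i : ℂ) + 1)⁻¹))) := by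
  have h0 : s ≠ 0 := by rintro rfl; simp at hs
  have hz : -1 < (s - 1).re := by simpa using hs
  induction j with
  | zero =>
    have h := hasSum_altBinom_div_sq_one (by linarith) h0
    rw [Complex.digamma_add_one_of_ne (by linarith) h0] at h
    simpa [add_assoc] using h
  | succ j ih =>
    have hne : s + j + 1 ≠ 0 := Complex.add_natCast_add_one_ne_zero (by linarith) j
    have hG := (hasSum_altBinom_div hs (j + 1)).sub (hasSum_altBinom_div hs j)
    have h := hasSum_of_telescoping
      ((((summable_altBinom_div hs (j + 1) 1).mul_left (s + j + 1)).sub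
        (ih.summable.mul_left ((j : ℂ) + 1))).sub hG.summable)
      (t := fun m => altBinom (s - 1) m * (m * (((m : ℂ) + (j + 1)) ^ (1 + 1))⁻¹)) (fun m => by
        rw [altBinom_succ]
        have h1 := Complex.natCast_add_one_ne_zero m
        have h2 := natCast_add_natCast_add_one_ne_zero m j
        have h4 : (m : ℂ) + 1 + (j + 1) ≠ 0 := by
          have := natCast_add_natCast_add_one_ne_zero (m + 1) j
          push_cast at this; exact this
        push_cast
        rw [show (m : ℂ) + (j + 1 + 1) = m + 1 + (j + 1) by ring]
        field_simp
        ring) (tendsto_natCast_mul_altBinom_div hz j 1)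
    have h' := ((h.add hG).add (ih.mul_left ((j : ℂ) + 1))).mul_left (s + j + 1)⁻¹
    simp only [sub_add_cancel, inv_mul_cancel_left₀ hne] at h'
    convert! h' using 1
    have h1 := Complex.natCast_add_one_ne_zero j
    rw [betaNat_succ, Finset.sum_range_succ _ (j + 1),
      Finset.sum_range_succ (fun i : ℕ => ((i : ℂ) + 1)⁻¹) j]
    push_cast
    rw [← add_assoc]
    simp only [zero_mul, mul_zero, sub_zero, zero_add]
    field_simp
    ring

/-- A crude linear bound suffices: the quadratic decay of `betaNat` and the extra factor 1/(j+1)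
absorb it. -/
theorem norm_sum_inv_sub_sum_inv_le {s : ℂ} (hs : 1 ≤ s.re) (j : ℕ) :
    ‖∑ i ∈ Finset.range (j + 1), (s + i)⁻¹ - ∑ i ∈ Finset.range j, ((i : ℂ) + 1)⁻¹‖ ≤
      2 * (j + 1) := by
  have h1 : ‖∑ i ∈ Finset.range (j + 1), (s + i)⁻¹‖ ≤ (j + 1 : ℕ) • (1 : ℝ) := by
    rw [← Finset.card_range (j + 1), ← Finset.sum_const]
    rw [Finset.card_range]
    refine norm_sum_le_of_le _ fun i _ => ?_
    rw [norm_inv]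
    refine inv_le_one_of_one_le₀ (le_trans ?_ (Complex.re_le_norm _))
    rw [Complex.re_add_natCast]
    linarith [i.cast_nonneg (α := ℝ)]
  have h2 : ‖∑ i ∈ Finset.range j, ((i : ℂ) + 1)⁻¹‖ ≤ j • (1 : ℝ) := by
    rw [← Finset.card_range j, ← Finset.sum_const]
    rw [Finset.card_range]
    refine norm_sum_le_of_le _ fun i _ => ?_
    rw [norm_inv, ← Nat.cast_succ, Complex.norm_natCast]
    exact inv_le_one_of_one_le₀ (by exact_mod_cast Nat.succ_le_succ i.zero_le)
  refine (norm_sub_le _ _).trans ((add_le_add h1 h2).trans ?_)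
  simp only [nsmul_eq_mul]
  push_cast
  linarith

/-- The term `B(j + 1, s) (ψ(s + j + 1) - ψ(j + 1)) / (j + 1)`. -/
noncomputable def betaDigammaTerm (s : ℂ) (j : ℕ) : ℂ :=
  betaNat s j * (Real.eulerMascheroniConstant + Complex.digamma s +
    (∑ i ∈ Finset.range (j + 1), (s + i)⁻¹ - ∑ i ∈ Finset.range j, ((i : ℂ) + 1)⁻¹)) *
      ((j : ℂ) + 1)⁻¹

theorem norm_betaDigammaTerm_le {s : ℂ} (hs : 2 ≤ s.re) (j : ℕ) :
    ‖betaDigammaTerm s j‖ ≤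
      2 / s.re * (‖(Real.eulerMascheroniConstant : ℂ) + Complex.digamma s‖ + 2) *
        (1 / ((j : ℝ) + 1) ^ 2) := by
  have hs0 : 0 < s.re := by linarith
  have hj : ‖(j : ℂ) + 1‖ = j + 1 := by
    rw [← Nat.cast_succ, Complex.norm_natCast]; push_cast; rfl
  have hj0 : (0 : ℝ) ≤ j := j.cast_nonneg
  set A := ‖(Real.eulerMascheroniConstant : ℂ) + Complex.digamma s‖ with hA
  have hA0 : 0 ≤ A := norm_nonneg _
  have h1 : ‖(Real.eulerMascheroniConstant : ℂ) + Complex.digamma s +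
      (∑ i ∈ Finset.range (j + 1), (s + i)⁻¹ - ∑ i ∈ Finset.range j, ((i : ℂ) + 1)⁻¹)‖ ≤
      (A + 2) * (j + 1) := by
    refine (norm_add_le_of_le le_rfl (norm_sum_inv_sub_sum_inv_le (by linarith) j)).trans ?_
    rw [← hA, add_mul]
    gcongr
    exact le_mul_of_one_le_right hA0 (by linarith)
  rw [betaDigammaTerm, norm_mul, norm_mul, norm_inv, hj]
  calc _ ≤ 2 / (s.re * (((j : ℝ) + 1) * (j + 2))) * ((A + 2) * (j + 1)) * ((j : ℝ) + 1)⁻¹ := by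
        gcongr
        exact norm_betaNat_le hs j
    _ ≤ 2 / (s.re * (((j : ℝ) + 1) * (j + 1))) * ((A + 2) * (j + 1)) * ((j : ℝ) + 1)⁻¹ := by
        gcongr
        norm_num
    _ = _ := by field_simp

theorem summable_betaDigammaTerm {s : ℂ} (hs : 2 ≤ s.re) : Summable (betaDigammaTerm s) :=
  .of_norm_bounded (summable_one_div_natCast_add_one_sq.mul_left _) (norm_betaDigammaTerm_le hs)

theorem tendsto_tsum_betaDigammaTerm {s : ℂ} (hs : 0 < s.re) :
    Tendsto (fun N : ℕ => ∑' j, betaDigammaTerm (s + N) j) atTop (𝓝 0) := by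
  set K := ∑' j : ℕ, 1 / ((j : ℝ) + 1) ^ 2
  have hK : 0 ≤ K := tsum_nonneg fun j => by positivity
  have hlim : Tendsto (fun N : ℕ => 2 * K * ((N : ℝ)⁻¹ *
      ‖(Real.eulerMascheroniConstant : ℂ) + Complex.digamma (s + N)‖ + 2 * (N : ℝ)⁻¹))
      atTop (𝓝 0) := by
    have := ((tendsto_digamma_add_natCast_div hs).add
      ((tendsto_inv_atTop_nhds_zero_nat (𝕜 := ℝ)).const_mul 2)).const_mul (2 * K)
    simpa using this
  refine squeeze_zero_norm' ?_ hlim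
  filter_upwards [eventually_two_le_re_add_natCast hs, eventually_gt_atTop 0] with N hN hN0
  have hN1 : (0 : ℝ) < N := by exact_mod_cast hN0
  calc _ ≤ 2 / (s + N).re * (‖(Real.eulerMascheroniConstant : ℂ) +
        Complex.digamma (s + N)‖ + 2) * K := by
        rw [← tsum_mul_left]
        exact tsum_of_norm_bounded (summable_one_div_natCast_add_one_sq.mul_left _).hasSum
          (norm_betaDigammaTerm_le hN)
    _ ≤ 2 / N * (‖(Real.eulerMascheroniConstant : ℂ) +
        Complex.digamma (s + N)‖ + 2) * K := by
        gcongr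
        rw [Complex.re_add_natCast]
        linarith
    _ = _ := by ring

/-! ### Expansion of the Newton series by partial fractions -/

theorem hasSum_zeta_three : HasSum (fun j : ℕ => (((j : ℂ) + 1) ^ 3)⁻¹) (riemannZeta 3) := by
  have h := (Complex.summable_add_natCast_pow_inv (s := 1) (by simp)
    (by norm_num : 2 ≤ 3)).hasSum
  rw [zeta_eq_tsum_one_div_nat_add_one_cpow (s := 3) (by simp)]
  convert! h using 2
  · rw [add_comm]
  · ext j
    rw [add_comm, Complex.cpow_ofNat, one_div]

theorem hasSum_zeta_two_complex :
    HasSum (fun j : ℕ => (((j : ℂ) + 1) ^ 2)⁻¹) ((Real.pi : ℂ) ^ 2 / 6) := by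
  have h := hasSum_polygamma_one (s := 1) (by simp)
  rw [polygamma_one_one] at h
  simpa only [add_comm] using h

theorem hasSum_altBinom_succ_partialFraction {s : ℂ} (hs : 0 < s.re) (j : ℕ) :
    HasSum (fun l : ℕ => -(altBinom (s - 1) (l + 1) * ((l : ℂ) + 1)⁻¹ *
      (((l : ℂ) + 2 + j) ^ 2)⁻¹))
      ((((j : ℂ) + 1) ^ 2)⁻¹ * (Real.eulerMascheroniConstant + Complex.digamma s) -
        2 * (((j : ℂ) + 1) ^ 3)⁻¹ + betaNat s j * (((j : ℂ) + 1) ^ 2)⁻¹ +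
        betaDigammaTerm s j) := by
  have hj := Complex.natCast_add_one_ne_zero j
  have h1 := hasSum_altBinom_succ_div (z := s - 1) (by simpa using hs)
  have h2 := (hasSum_nat_add_iff' 1).2 (hasSum_altBinom_div hs j)
  -- With m = l + 1 and x = j + 1, 1/(m(m+x)²) = x⁻²(1/m - 1/(m+x)) - x⁻¹/(m+x)². The omitted m = 0
  -- terms in `h2` and `h3` contribute -x⁻³ each, the source of -2ζ(3).
  have h3 := (hasSum_nat_add_iff' 1).2 (hasSum_altBinom_div_sq hs j)
  rw [sub_add_cancel] at h1
  have h := ((h1.add h2).mul_left ((((j : ℂ) + 1) ^ 2)⁻¹)).add (h3.mul_left (((j : ℂ) + 1)⁻¹))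
  convert! h using 1
  · ext l
    have h4 := Complex.natCast_add_one_ne_zero l
    have h5 : (l : ℂ) + 2 + j ≠ 0 := by
      have := natCast_add_natCast_add_one_ne_zero (l + 1) j
      push_cast at this
      convert this using 1
      ring
    rw [show ((l + 1 : ℕ) : ℂ) + (j + 1) = l + 2 + j by push_cast; ring]
    field_simp
    ring
  · simp only [Finset.range_one, Finset.sum_singleton, altBinom_zero, Nat.cast_zero, zero_add,
      one_mul, betaDigammaTerm]
    field_simp
    ring

theorem polygammaNewtonSeries_eq {s : ℂ} (hs : 2 ≤ s.re) :
    polygammaNewtonSeries s =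
      (Real.pi : ℂ) ^ 2 / 6 * (Real.eulerMascheroniConstant + Complex.digamma s) -
        2 * riemannZeta 3 + betaSqSeries s + ∑' j, betaDigammaTerm s j := by
  have hs0 : 0 < s.re := by linarith
  have hc : Summable fun l => altBinom (s - 1) (l + 1) :=
    (summable_nat_add_iff 1).2 (summable_altBinom (by simp; linarith))
  have hsum : Summable fun x : ℕ × ℕ => -(altBinom (s - 1) (x.1 + 1) * ((x.1 : ℂ) + 1)⁻¹ *
      (((x.1 : ℂ) + 2 + x.2) ^ 2)⁻¹) := by
    refine .of_norm_bounded (hc.norm.mul_of_nonneg summable_one_div_natCast_add_one_sq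
      (fun _ => norm_nonneg _) (fun _ => by positivity)) fun x => ?_
    have h1 : ‖((x.1 : ℂ) + 1)⁻¹‖ ≤ 1 := by
      rw [norm_inv, ← Nat.cast_succ, Complex.norm_natCast]
      exact inv_le_one_of_one_le₀ (by exact_mod_cast Nat.succ_le_succ x.1.zero_le)
    have h2 := Complex.natCast_add_one_pow_inv_bound (s := (x.1 : ℂ) + 1)
      (by simp; positivity) x.2 le_rfl
    rw [show (x.1 : ℂ) + 1 + x.2 + 1 = x.1 + 2 + x.2 by ring] at h2
    rw [norm_neg, norm_mul, norm_mul]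
    gcongr
    exact mul_le_of_le_one_right (norm_nonneg _) h1
  have hrow : ∀ l : ℕ, HasSum (fun j : ℕ => -(altBinom (s - 1) (l + 1) * ((l : ℂ) + 1)⁻¹ *
      (((l : ℂ) + 2 + j) ^ 2)⁻¹))
      (-(altBinom (s - 1) (l + 1) * polygamma 1 ((l : ℂ) + 2) * ((l : ℂ) + 1)⁻¹)) := fun l => by
    have h := ((hasSum_polygamma_one (s := (l : ℂ) + 2) (by simp; positivity)).mul_left
      (altBinom (s - 1) (l + 1) * ((l : ℂ) + 1)⁻¹)).neg
    convert! h using 1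
    ring
  have h1 := hsum.hasSum.prod_fiberwise hrow
  have h2 := ((Equiv.prodComm ℕ ℕ).hasSum_iff.2 hsum.hasSum).prod_fiberwise
    (fun j => hasSum_altBinom_succ_partialFraction hs0 j)
  have h3 := (((hasSum_zeta_two_complex.mul_right
    (Real.eulerMascheroniConstant + Complex.digamma s)).sub (hasSum_zeta_three.mul_left 2)).add
    (summable_betaNat_div_sq (s := s) (by linarith)).hasSum).add
    (summable_betaDigammaTerm hs).hasSum
  rw [polygammaNewtonSeries, h1.tsum_eq, h2.unique h3, betaSqSeries]

/-! ### Periodicity and vanishing of the defect -/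

/-- The difference between `betaSqSeries s` and its closed form. -/
noncomputable def betaSqSeriesDefect (s : ℂ) : ℂ :=
  betaSqSeries s - (1 / 2 * polygamma 2 s
    - (polygamma 1 s + (Real.pi : ℂ) ^ 2 / 6) *
      ((Real.eulerMascheroniConstant : ℂ) + Complex.digamma s)
    + 2 * riemannZeta 3 + polygammaNewtonSeries s)

theorem betaSqSeriesDefect_add_one {s : ℂ} (hs : -1 < s.re) (h0 : s ≠ 0) :
    betaSqSeriesDefect (s + 1) = betaSqSeriesDefect s := by
  have h1 := betaSqSeries_sub hs h0
  have h2 := polygammaNewtonSeries_sub hs h0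
  have h3 : betaSqSeries (s + 1) = betaSqSeries s - polygamma 1 (s + 1) / s := by
    rw [← h1]; ring
  rw [betaSqSeriesDefect, betaSqSeriesDefect, h3, eq_add_of_sub_eq h2,
    polygamma_one_add_one hs h0, polygamma_two_add_one hs h0,
    Complex.digamma_add_one_of_ne hs h0]
  field_simp
  ring

theorem betaSqSeriesDefect_eq {s : ℂ} (hs : 2 ≤ s.re) :
    betaSqSeriesDefect s = polygamma 1 s *
      ((Real.eulerMascheroniConstant : ℂ) + Complex.digamma s) - 1 / 2 * polygamma 2 s -
      ∑' j, betaDigammaTerm s j := by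
  rw [betaSqSeriesDefect, polygammaNewtonSeries_eq hs]
  ring

theorem tendsto_polygamma_one_mul_digamma {s : ℂ} (hs : 0 < s.re) :
    Tendsto (fun N : ℕ => polygamma 1 (s + N) *
      ((Real.eulerMascheroniConstant : ℂ) + Complex.digamma (s + N))) atTop (𝓝 0) := by
  obtain ⟨C, hC⟩ := exists_norm_polygamma_one_le
  have hC0 : 0 ≤ C := by
    have := (norm_nonneg _).trans (hC 2 (by simp))
    rw [Complex.re_ofNat] at this
    linarith
  have hlim := (tendsto_digamma_add_natCast_div hs).const_mul C
  rw [mul_zero] at hlim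
  refine squeeze_zero_norm' ?_ hlim
  filter_upwards [eventually_two_le_re_add_natCast hs, eventually_gt_atTop 0] with N hN hN0
  have hN1 : (0 : ℝ) < N := by exact_mod_cast hN0
  rw [norm_mul, ← mul_assoc]
  gcongr
  refine (hC _ hN).trans ?_
  rw [div_eq_mul_inv, Complex.re_add_natCast]
  gcongr
  linarith

theorem betaSqSeriesDefect_eq_zero {s : ℂ} (hs : -1 < s.re) (h0 : s ≠ 0) :
    betaSqSeriesDefect s = 0 := by
  have hpos : ∀ z : ℂ, 0 < z.re → betaSqSeriesDefect z = 0 := fun z hz => by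
    refine eq_zero_of_add_one_eq_of_tendsto hz (fun w hw => betaSqSeriesDefect_add_one
      (by linarith) (by rintro rfl; simp at hw)) ?_
    have h := ((tendsto_polygamma_one_mul_digamma hz).sub
      ((tendsto_polygamma_two_add_natCast hz).const_mul (1 / 2))).sub
      (tendsto_tsum_betaDigammaTerm hz)
    simp only [mul_zero, sub_zero] at h
    refine h.congr' ?_
    filter_upwards [eventually_two_le_re_add_natCast hz] with N hN
    exact (betaSqSeriesDefect_eq hN).symm
  -- One unit shift carries the remaining strip -1 < Re s ≤ 0, s ≠ 0, into the half-plane already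
  -- settled.
  rw [← betaSqSeriesDefect_add_one hs h0]
  exact hpos _ (by simp; linarith)

/-! ### Translation to the hypergeometric and Gamma-quotient series -/

theorem hypergeometricTerm_eq_betaNat {s : ℂ} (h0 : s ≠ 0) (k : ℕ) :
    hypergeometricTerm {1, 1, 1, 1} {2, 2, 1 + s} 1 k =
      s * (betaNat s k * (((k : ℂ) + 1) ^ 2)⁻¹) := by
  have h3 : ∏ i ∈ Finset.range (k + 1), (s + i) = (ascPochhammer ℂ k).eval (1 + s) * s := by
    rw [Finset.prod_range_succ', Nat.cast_zero, add_zero]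
    congr 1
    induction k with
    | zero => simp
    | succ k ih =>
      rw [Finset.prod_range_succ, ascPochhammer_succ_eval, ih]
      push_cast
      ring
  have h1 : (ascPochhammer ℂ k).eval 1 = k.factorial := ascPochhammer_eval_one ℂ k
  have h2 : (ascPochhammer ℂ k).eval 2 = (k + 1) * k.factorial := by
    have := ascPochhammer_nat_eq_natCast_ascFactorial ℂ 2 k
    rw [Nat.cast_two, Nat.ascFactorial_eq_factorial_mul_choose] at this
    have hk : Nat.choose (1 + k) k = k + 1 := by
      rw [add_comm, Nat.choose_succ_self_right]
    rw [this, hk]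
    push_cast
    ring
  have hf : (k.factorial : ℂ) ≠ 0 := by exact_mod_cast k.factorial_ne_zero
  have hk := Complex.natCast_add_one_ne_zero k
  simp only [hypergeometricTerm, Multiset.insert_eq_cons, Multiset.map_cons, Multiset.prod_cons,
    Multiset.map_singleton, Multiset.prod_singleton, h1, h2, betaNat, h3, one_pow]
  field_simp

/-- The induction uses the recurrence of the entire function 1/Γ, which holds at its zeros too, so
positive integers s need no separate case. -/
theorem Complex.Gamma_mul_inv_Gamma_sub_natCast {s : ℂ} (hs : Complex.Gamma s ≠ 0) (m : ℕ) :
    Complex.Gamma s * ((Complex.Gamma (s - m))⁻¹ * (Complex.Gamma (m + 1))⁻¹) =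
      (-1) ^ m * altBinom (s - 1) m := by
  induction m with
  | zero => simp [hs]
  | succ m ih =>
    have h1 := Complex.one_div_Gamma_eq_self_mul_one_div_Gamma_add_one (s - (m + 1 : ℕ))
    have hm := Complex.natCast_add_one_ne_zero m
    rw [show s - ((m + 1 : ℕ) : ℂ) + 1 = s - m by push_cast; ring] at h1
    rw [h1, Nat.cast_succ, Complex.Gamma_add_one _ hm, altBinom_succ, pow_succ]
    rw [show (-1 : ℂ) ^ m * -1 * (altBinom (s - 1) m * ((m - (s - 1)) / (m + 1))) =
      ((-1) ^ m * altBinom (s - 1) m) * ((s - (m + 1)) / (m + 1)) by ring, ← ih, mul_inv]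
    ring

theorem Gamma_mul_polygammaSeriesTerm {s : ℂ} (hs : Complex.Gamma s ≠ 0) (l : ℕ) :
    Complex.Gamma s * polygammaSeriesTerm s l =
      -(altBinom (s - 1) (l + 1) * polygamma 1 ((l : ℂ) + 2) * ((l : ℂ) + 1)⁻¹) := by
  have h := Complex.Gamma_mul_inv_Gamma_sub_natCast hs (l + 1)
  rw [show s - ((l + 1 : ℕ) : ℂ) = s - l - 1 by push_cast; ring,
    show ((l + 1 : ℕ) : ℂ) + 1 = l + 2 by push_cast; ring] at h
  have h2 : ((-1 : ℂ) ^ l) * (-1) ^ l = 1 := by rw [← mul_pow]; simp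
  rw [polygammaSeriesTerm]
  linear_combination ((-1) ^ l * polygamma 1 ((l : ℂ) + 2) * ((l : ℂ) + 1)⁻¹) * h -
    (altBinom (s - 1) (l + 1) * polygamma 1 ((l : ℂ) + 2) * ((l : ℂ) + 1)⁻¹) * h2

theorem polygammaSeriesTerm_natCast_eq_zero {n l : ℕ} (h : n ≤ l + 1) :
    polygammaSeriesTerm n l = 0 := by
  obtain ⟨d, hd⟩ := Nat.exists_eq_add_of_le h
  have : (n : ℂ) - l - 1 = -d := by
    have : (l : ℂ) + 1 = n + d := by exact_mod_cast hd
    linear_combination -this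
  -- `Complex.Gamma` takes the value 0 at its poles and 0⁻¹ = 0, which agrees with the zero of 1/Γ
  -- there.
  rw [polygammaSeriesTerm, this, Complex.Gamma_neg_nat_eq_zero]
  simp

theorem hypergeometricPFQ_one_one_one_one_eq {s : ℂ} (hs : -1 < s.re) (h0 : s ≠ 0) :
    Summable (hypergeometricTerm {1, 1, 1, 1} {2, 2, 1 + s} 1) ∧
      Summable (polygammaSeriesTerm s) ∧
      1 / s * hypergeometricPFQ {1, 1, 1, 1} {2, 2, 1 + s} 1 =
        1 / 2 * polygamma 2 s
          - (polygamma 1 s + (Real.pi : ℂ) ^ 2 / 6) *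
            ((Real.eulerMascheroniConstant : ℂ) + Complex.digamma s)
          + 2 * riemannZeta 3
          + Complex.Gamma s * ∑' l : ℕ, polygammaSeriesTerm s l := by
  have hG : Complex.Gamma s ≠ 0 := Complex.Gamma_ne_zero fun m h =>
    Complex.add_natCast_ne_zero hs h0 m (by rw [h]; ring)
  have hterm := Gamma_mul_polygammaSeriesTerm hG
  refine ⟨?_, ?_, ?_⟩
  · rw [funext (hypergeometricTerm_eq_betaNat h0)]
    exact (summable_betaNat_div_sq hs).mul_left s
  · rw [← summable_mul_left_iff hG, funext hterm]
    exact summable_polygammaNewtonSeries hs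
  · have h := betaSqSeriesDefect_eq_zero hs h0
    rw [betaSqSeriesDefect, sub_eq_zero, polygammaNewtonSeries] at h
    rw [hypergeometricPFQ, funext (hypergeometricTerm_eq_betaNat h0), tsum_mul_left,
      ← tsum_mul_left (a := Complex.Gamma s), funext hterm, ← h, betaSqSeries]
    field_simp

theorem theorem2p2 :
    (∀ μ : ℂ, -1 < μ.re → μ ≠ 0 →
      Summable (hypergeometricTerm {1, 1, 1, 1} {2, 2, 1 + μ} 1) ∧
      Summable (polygammaSeriesTerm μ) ∧
      1 / μ * hypergeometricPFQ {1, 1, 1, 1} {2, 2, 1 + μ} 1 =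
        1 / 2 * polygamma 2 μ
          - (polygamma 1 μ + (Real.pi : ℂ) ^ 2 / 6) *
            ((Real.eulerMascheroniConstant : ℂ) + Complex.digamma μ)
          + 2 * riemannZeta 3
          + Complex.Gamma μ * ∑' l : ℕ, polygammaSeriesTerm μ l) ∧
    (∀ n : ℕ, 1 ≤ n →
      (∀ l : ℕ, n ≤ l + 1 → polygammaSeriesTerm n l = 0) ∧
      1 / (n : ℂ) * hypergeometricPFQ {1, 1, 1, 1} {2, 2, 1 + (n : ℂ)} 1 =
        1 / 2 * polygamma 2 n
          - (polygamma 1 n + (Real.pi : ℂ) ^ 2 / 6) *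
            ((Real.eulerMascheroniConstant : ℂ) + Complex.digamma n)
          + 2 * riemannZeta 3
          + Complex.Gamma n * ∑ l ∈ Finset.range (n - 1), polygammaSeriesTerm n l) := by
  refine ⟨fun μ hμ h0 => hypergeometricPFQ_one_one_one_one_eq hμ h0, fun n hn =>
    ⟨fun l hl => polygammaSeriesTerm_natCast_eq_zero hl, ?_⟩⟩
  have hn0 : (n : ℂ) ≠ 0 := by exact_mod_cast (by omega : n ≠ 0)
  have hre : -1 < (n : ℂ).re := by simp; linarith [n.cast_nonneg (α := ℝ)]
  rw [(hypergeometricPFQ_one_one_one_one_eq hre hn0).2.2,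
    tsum_eq_sum (s := Finset.range (n - 1)) fun l hl => polygammaSeriesTerm_natCast_eq_zero (by
      rw [Finset.mem_range] at hl; omega)]
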